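/- Let $H_{11}\in\mathbb{C}^{M_1\times N_1}$, $H_{11}\ne 0$, and $H_{21}\in\mathbb{C}^{M_1\times N_2}$ be the channels from users 1 and 2 to receiver 1 (unit-covariance noise), let $S_2\succeq 0$ and $r_2\in\mathbb{R}$ be the fixed transmit covariance and rate of user 2, and let $P_1>0$. Write $|\cdot|$ for the determinant, $\log$ for the natural logarithm, $\mathcal{F}=\{S_1\succeq 0:\operatorname{tr}S_1\le P_1\}$, and $$A(S_1)=\log|I+H_{11}S_1H_{11}^H|,\qquad B(S_1)=\log|I+H_{11}S_1H_{11}^H+H_{21}S_2H_{21}^H|,$$ $$R_2^{(a)}(S_1)=\log|I+(I+H_{11}S_1H_{11}^H)^{-1}H_{21}S_2H_{21}^H|,\qquad R_2^{(b)}=\log|I+H_{21}S_2H_{21}^H|.$$ For $S_1\in\mathcal F$, opportunistic multiuser detection (OMD) uses successive decoding (SD) if $r_2\le R_2^{(a)}(S_1)$, joint decoding (JD) if $R_2^{(a)}(S_1)<r_2\le R_2^{(b)}$, and single-user decoding (SUD) if $r_2>R_2^{(b)}$, with rates $$r_1(S_1)=\begin{cases}A(S_1), & r_2\le R_2^{(a)}(S_1),\\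 B(S_1)-r_2, & R_2^{(a)}(S_1)<r_2\le R_2^{(b)},\\ \log|I+(I+H_{21}S_2H_{21}^H)^{-1}H_{11}S_1H_{11}^H|, & r_2>R_2^{(b)}.\end{cases}$$ Problem (P1) is to maximize $r_1(S_1)$ over $S_1\in\mathcal F$; write $S_1^{\rm OMD}$ and $r_1^{\rm OMD}$ for its optimal solution and optimal value. For a matrix $H\in\mathbb{C}^{M_1\times N_1}$ with thin singular-value decomposition $H=U\,\mathrm{diag}(\sigma_1,\dots,\sigma_T)V^H$, $T=\min(N_1,M_1)$, the water-filling solution on $H$ is $V\,\mathrm{diag}(p_1,\dots,p_T)V^H$ with $p_i=(\mu-1/\sigma_i^2)^+$ ($p_i=0$ if $\sigma_i=0$), where $\mu$ is such that $\sum_i p_i=P_1$; its rate is $\sum_i\log(1+\sigma_i^2p_i)$. Let $(S_1^{\rm SD},r_1^{\rm SD})$ be the water-filling solution on $H_{11}$ and its rate, let $(S_1^{\rm SUD},r_1^{\rm SUD})$ be those on the whitened channel $(I+H_{21}S_2H_{21}^H)^{-1/2}H_{11}$, and put $\hat R_2^{(a)}=R_2^{(a)}(S_1^{\rm SD})$,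 $\bar R_2^{(a)}=R_2^{(a)}(S_1^{\rm SUD})$. Finally, let $$g(\mu_1,\mu_2)=\sup_{r_1\ge 0,\;S_1\in\mathcal F}\ \bigl[r_1-\mu_1\bigl(r_1-A(S_1)\bigr)-\mu_2\bigl(r_1-B(S_1)+r_2\bigr)\bigr]\in(-\infty,+\infty],$$ let $(\mu_1^*,\mu_2^*)$ be any minimizer of $g$ over $\mu_1,\mu_2\ge 0$, and let $\tilde S_1^{\rm SD}$ be any maximizer of $\mu_1^*A(S_1)+(1-\mu_1^*)B(S_1)$ over $\mathcal F$. Then the two water-filling solutions exist, $\hat R_2^{(a)}\le\bar R_2^{(a)}\le R_2^{(b)}$, and in each of the following cases (P1) has exactly one optimal solution $S_1^{\rm OMD}$, which, together with $r_1^{\rm OMD}$ and the decoding method that OMD uses at $S_1^{\rm OMD}$, is as follows: 1. if $0<r_2<\hat R_2^{(a)}$, then $S_1^{\rm OMD}=S_1^{\rm SD}$ and $r_1^{\rm OMD}=r_1^{\rm SD}$, with SD; 2. if $\hat R_2^{(a)}\le r_2\le\bar R_2^{(a)}$, then $(\mu_1^*,\mu_2^*)$ and $\tilde S_1^{\rm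 SD}$ exist, and for every choice of them $S_1^{\rm OMD}=\tilde S_1^{\rm SD}$ and $r_1^{\rm OMD}=A(\tilde S_1^{\rm SD})$, with SD; 3. if $\bar R_2^{(a)}<r_2\le R_2^{(b)}$, then $S_1^{\rm OMD}=S_1^{\rm SUD}$ and $r_1^{\rm OMD}=r_1^{\rm SUD}+R_2^{(b)}-r_2$, with JD; 4. if $r_2>R_2^{(b)}$, then $S_1^{\rm OMD}=S_1^{\rm SUD}$ and $r_1^{\rm OMD}=r_1^{\rm SUD}$, with SUD. -/

import Mathlib

open Matrix
open scoped ComplexOrder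

noncomputable section

namespace OMD

/-- `log |A|` for a square complex matrix (natural logarithm).  It is used only for matrices whose
determinant is a positive real number. -/
def logDet {m : ℕ} (A : Matrix (Fin m) (Fin m) ℂ) : ℝ := Real.log A.det.re

/-- The received covariance `H S Hᴴ` of a signal with transmit covariance `S` sent through the
channel `H`. -/
def rx {m n : ℕ} (H : Matrix (Fin m) (Fin n) ℂ) (S : Matrix (Fin n) (Fin n) ℂ) :
    Matrix (Fin m) (Fin m) ℂ := H * S * Hᴴ

/-- The constraint set of the covariance of user 1: `S ⪰ 0` and `tr S ≤ P`. -/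
def feasible (n : ℕ) (P : ℝ) : Set (Matrix (Fin n) (Fin n) ℂ) :=
  {S | S.PosSemidef ∧ S.trace.re ≤ P}

section Rates

variable {m n₁ n₂ : ℕ} (H₁₁ : Matrix (Fin m) (Fin n₁) ℂ) (H₂₁ : Matrix (Fin m) (Fin n₂) ℂ)
  (S₂ : Matrix (Fin n₂) (Fin n₂) ℂ)

/-- `log |I + H₁₁ S₁ H₁₁ᴴ|`: the capacity of user 1 without the presence of user 2. -/
def ownRate (S₁ : Matrix (Fin n₁) (Fin n₁) ℂ) : ℝ := logDet (1 + rx H₁₁ S₁)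

/-- `log |I + H₁₁ S₁ H₁₁ᴴ + H₂₁ S₂ H₂₁ᴴ|`: the sum rate at the receiver of user 1. -/
def sumRate (S₁ : Matrix (Fin n₁) (Fin n₁) ℂ) : ℝ := logDet (1 + rx H₁₁ S₁ + rx H₂₁ S₂)

/-- `log |I + (I + H₂₁ S₂ H₂₁ᴴ)⁻¹ H₁₁ S₁ H₁₁ᴴ|`: the rate of user 1 when user 2 is treated as
colored Gaussian noise. -/
def noiseRate (S₁ : Matrix (Fin n₁) (Fin n₁) ℂ) : ℝ :=
  logDet (1 + (1 + rx H₂₁ S₂)⁻¹ * rx H₁₁ S₁)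

/-- `R₂⁽ᵃ⁾`, as a function of `S₁`. -/
def Ra (S₁ : Matrix (Fin n₁) (Fin n₁) ℂ) : ℝ :=
  logDet (1 + (1 + rx H₁₁ S₁)⁻¹ * rx H₂₁ S₂)

/-- `R₂⁽ᵇ⁾`, which does not depend on `S₁`. -/
def Rb : ℝ := logDet (1 + rx H₂₁ S₂)

/-- Successive decoding, joint decoding, and single-user decoding. -/
inductive Decoding
  | SD
  | JD
  | SUD

/-- The decoding method that opportunistic multiuser detection uses for a given `S₁`: successive
decoding under strong interference, joint decoding under moderate interference, and single-user
decoding under weak interference. -/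
def omdDecoding (r₂ : ℝ) (S₁ : Matrix (Fin n₁) (Fin n₁) ℂ) : Decoding :=
  open scoped Classical in
  if r₂ ≤ Ra H₁₁ H₂₁ S₂ S₁ then .SD else if r₂ ≤ Rb H₂₁ S₂ then .JD else .SUD

/-- The maximum rate of user 1 under each decoding method. -/
def decodingRate (r₂ : ℝ) (S₁ : Matrix (Fin n₁) (Fin n₁) ℂ) : Decoding → ℝ
  | .SD => ownRate H₁₁ S₁
  | .JD => sumRate H₁₁ H₂₁ S₂ S₁ - r₂
  | .SUD => noiseRate H₁₁ H₂₁ S₂ S₁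

/-- The rate `r₁(S₁)` of user 1 with opportunistic multiuser detection. -/
def omdRate (r₂ : ℝ) (S₁ : Matrix (Fin n₁) (Fin n₁) ℂ) : ℝ :=
  decodingRate H₁₁ H₂₁ S₂ r₂ S₁ (omdDecoding H₁₁ H₂₁ S₂ r₂ S₁)

/-- `S` is the (unique) optimal covariance of problem (P1), `r` is the optimal value, and `d` is
the decoding method used at the optimum. -/
structure IsOMDSolution (P r₂ : ℝ) (S : Matrix (Fin n₁) (Fin n₁) ℂ) (r : ℝ) (d : Decoding) :
    Prop where
  optimal_iff : ∀ S' : Matrix (Fin n₁) (Fin n₁) ℂ,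
    (S' ∈ feasible n₁ P ∧ IsMaxOn (omdRate H₁₁ H₂₁ S₂ r₂) (feasible n₁ P) S') ↔ S' = S
  value_eq : omdRate H₁₁ H₂₁ S₂ r₂ S = r
  decoding_eq : omdDecoding H₁₁ H₂₁ S₂ r₂ S = d

/-- The Lagrangian of the problem (P2) of maximizing `r₁` subject to `r₁ ≤ ownRate S₁`,
`r₁ ≤ sumRate S₁ - r₂`, `r₁ ≥ 0`, and `S₁` feasible; only the two rate constraints are
dualized. -/
def lagrangian (r₂ r₁ : ℝ) (S₁ : Matrix (Fin n₁) (Fin n₁) ℂ) (μ₁ μ₂ : ℝ) : ℝ :=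
  r₁ - μ₁ * (r₁ - ownRate H₁₁ S₁) - μ₂ * (r₁ - sumRate H₁₁ H₂₁ S₂ S₁ + r₂)

/-- The Lagrange dual function of (P2); its value may be `+∞`. -/
def dualFun (P r₂ μ₁ μ₂ : ℝ) : EReal :=
  ⨆ x : {x : ℝ × Matrix (Fin n₁) (Fin n₁) ℂ // 0 ≤ x.1 ∧ x.2 ∈ feasible n₁ P},
    ((lagrangian H₁₁ H₂₁ S₂ r₂ x.1.1 x.1.2 μ₁ μ₂ : ℝ) : EReal)

/-- `(μ₁, μ₂)` is an optimal solution of the dual problem (P2-D). -/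
def IsDualOptimal (P r₂ μ₁ μ₂ : ℝ) : Prop :=
  0 ≤ μ₁ ∧ 0 ≤ μ₂ ∧ ∀ ν₁ ν₂ : ℝ, 0 ≤ ν₁ → 0 ≤ ν₂ →
    dualFun H₁₁ H₂₁ S₂ P r₂ μ₁ μ₂ ≤ dualFun H₁₁ H₂₁ S₂ P r₂ ν₁ ν₂

/-- `S` is an optimal solution of (P3) with weight `μ₁`. -/
def IsP3Solution (P μ₁ : ℝ) (S : Matrix (Fin n₁) (Fin n₁) ℂ) : Prop :=
  S ∈ feasible n₁ P ∧
    IsMaxOn (fun S' => μ₁ * ownRate H₁₁ S' + (1 - μ₁) * sumRate H₁₁ H₂₁ S₂ S')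
      (feasible n₁ P) S

open scoped MatrixOrder Matrix.Norms.L2Operator in
/-- The equivalent channel of user 1 after noise whitening,
`(I + H₂₁ S₂ H₂₁ᴴ)^(-1/2) H₁₁`. -/
def whitened : Matrix (Fin m) (Fin n₁) ℂ := CFC.sqrt ((1 + rx H₂₁ S₂)⁻¹) * H₁₁

end Rates

/-- The power allotted to a mode of gain `σ` at water level `μ`: `(μ - 1/σ²)⁺`, where
`1/0² = +∞`. -/
def waterPower (μ σ : ℝ) : ℝ := if σ = 0 then 0 else max (μ - 1 / σ ^ 2) 0

/-- `S` is the water-filling covariance for the channel `H` and the power `P`, and `r` is the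
corresponding rate: `H = U Σ Vᴴ` is a thin singular-value decomposition, `S = V Λ Vᴴ` with the
water-filling powers on the diagonal of `Λ`, and `r = ∑ log (1 + σᵢ² pᵢ)`. -/
def IsWaterFilling {m n : ℕ} (H : Matrix (Fin m) (Fin n) ℂ) (P : ℝ)
    (S : Matrix (Fin n) (Fin n) ℂ) (r : ℝ) : Prop :=
  ∃ (U : Matrix (Fin m) (Fin (min n m)) ℂ) (V : Matrix (Fin n) (Fin (min n m)) ℂ)
    (σ : Fin (min n m) → ℝ) (μ : ℝ),
    Uᴴ * U = 1 ∧ Vᴴ * V = 1 ∧ (∀ i, 0 ≤ σ i) ∧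
    H = U * diagonal (fun i => (σ i : ℂ)) * Vᴴ ∧
    ∑ i, waterPower μ (σ i) = P ∧
    S = V * diagonal (fun i => (waterPower μ (σ i) : ℂ)) * Vᴴ ∧
    r = ∑ i, Real.log (1 + σ i ^ 2 * waterPower μ (σ i))

end OMD

end

/-!
If `r₂ ≤ R₂⁽ᵇ⁾`, the rate of opportunistic multiuser detection is `min A (B - r₂)`, so for every
`μ ∈ [0, 1]` it is majorized by `μ A + (1 - μ) (B - r₂)`. The objective `μ A + (1 - μ) B` is a
strictly increasing and strictly concave function of the received covariance `H₁₁ S₁ H₁₁ᴴ`, and a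
maximizer over `S₁` spends no power on the kernel of `H₁₁`, so the maximizer is unique. Whenever the
two rates agree at this maximizer, it is therefore the only optimum of (P1). For `μ = 1` it is the
water-filling solution on `H₁₁`, for `μ = 0` the one on the whitened channel, and between the two
thresholds strong duality supplies the weight `μ₁`.
-/

namespace OMD

section Optimization

/-- `a` is the one and only maximizer of `f` on `s`, encoded as strict domination of all the other
values, so that it passes to functions lying below `f` and agreeing with it at `a`. -/
def IsUniqueMaxOn {α β : Type*} [Preorder β] (f : α → β) (s : Set α) (a : α) : Prop :=
  a ∈ s ∧ ∀ x ∈ s, x ≠ a → f x < f a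

namespace IsUniqueMaxOn

variable {α β : Type*}

lemma isMaxOn [Preorder β] {f : α → β} {s : Set α} {a : α} (h : IsUniqueMaxOn f s a) :
    IsMaxOn f s a := by
  refine isMaxOn_iff.mpr fun x hx => ?_
  rcases eq_or_ne x a with rfl | hne
  · exact le_rfl
  · exact (h.2 x hx hne).le

lemma mem_and_isMaxOn_iff [Preorder β] {f : α → β} {s : Set α} {a x : α}
    (h : IsUniqueMaxOn f s a) : (x ∈ s ∧ IsMaxOn f s x) ↔ x = a := by
  refine ⟨fun ⟨hx, hmax⟩ => by_contra fun hne => ?_, ?_⟩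
  · exact (h.2 x hx hne).not_ge (isMaxOn_iff.mp hmax a h.1)
  · rintro rfl
    exact ⟨h.1, h.isMaxOn⟩

lemma of_le_of_eq [Preorder β] {f g : α → β} {s : Set α} {a : α} (h : IsUniqueMaxOn f s a)
    (hle : ∀ x ∈ s, g x ≤ f x) (heq : g a = f a) : IsUniqueMaxOn g s a :=
  ⟨h.1, fun x hx hne => (hle x hx).trans_lt (heq.symm ▸ h.2 x hx hne)⟩

lemma sub_const {f : α → ℝ} {s : Set α} {a : α} (h : IsUniqueMaxOn f s a) (c : ℝ) :
    IsUniqueMaxOn (fun x => f x - c) s a :=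
  ⟨h.1, fun x hx hne => sub_lt_sub_right (h.2 x hx hne) c⟩

lemma of_isMaxOn_of_forall_eq [LinearOrder β] {f : α → β} {s : Set α} {a : α} (ha : a ∈ s)
    (hmax : IsMaxOn f s a) (huniq : ∀ x ∈ s, IsMaxOn f s x → x = a) : IsUniqueMaxOn f s a := by
  refine ⟨ha, fun x hx hne => lt_of_not_ge fun hle => hne (huniq x hx ?_)⟩
  exact isMaxOn_iff.mpr fun y hy => (isMaxOn_iff.mp hmax y hy).trans hle

end IsUniqueMaxOn

variable {ι E : Type*} {s : Set E} {f : ι → E → ℝ}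

/-- The points lying strictly below some value, on `s`, of the vector-valued function `(f i)ᵢ`. -/
def strictHypographImage (s : Set E) (f : ι → E → ℝ) : Set (ι → ℝ) :=
  ⋃ x ∈ s, Set.univ.pi fun i => Set.Iio (f i x)

lemma mem_strictHypographImage {z : ι → ℝ} :
    z ∈ strictHypographImage s f ↔ ∃ x ∈ s, ∀ i, z i < f i x := by
  simp [strictHypographImage]

lemma isOpen_strictHypographImage [Finite ι] (s : Set E) (f : ι → E → ℝ) :
    IsOpen (strictHypographImage s f) :=
  isOpen_biUnion fun _ _ => isOpen_set_pi Set.finite_univ fun _ _ => isOpen_Iio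

variable [AddCommGroup E] [Module ℝ E]

lemma convex_strictHypographImage [Nonempty ι] (hf : ∀ i, ConcaveOn ℝ s (f i)) :
    Convex ℝ (strictHypographImage s f) := by
  intro y hy z hz a b ha hb hab
  obtain ⟨x, hx, hyx⟩ := mem_strictHypographImage.mp hy
  obtain ⟨x', hx', hzx'⟩ := mem_strictHypographImage.mp hz
  have hs : Convex ℝ s := (hf (Classical.arbitrary ι)).1
  refine mem_strictHypographImage.mpr
    ⟨a • x + b • x', hs hx hx' ha hb hab, fun i => ?_⟩
  refine lt_of_lt_of_le ?_ ((hf i).2 hx hx' ha hb hab)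
  simp only [Pi.add_apply, Pi.smul_apply, smul_eq_mul]
  have := hyx i
  have := hzx' i
  rcases ha.eq_or_lt with rfl | ha
  · obtain rfl : b = 1 := by linarith
    simpa
  · nlinarith

lemma nonneg_and_sum_mul_le_of_forall_lt [Fintype ι] {q u : ι → ℝ} {c : ℝ}
    (h : ∀ z : ι → ℝ, (∀ i, z i < u i) → ∑ i, q i * z i < c) :
    (∀ i, 0 ≤ q i) ∧ ∑ i, q i * u i ≤ c := by
  classical
  have hq (i : ι) : 0 ≤ q i := by
    by_contra! hi
    set d := ∑ j, q j * (u j - 1)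
    set t := |c - d| / -q i
    have ht : 0 ≤ t := div_nonneg (abs_nonneg _) (neg_nonneg.mpr hi.le)
    have hz := h (fun j => u j - 1 - if i = j then t else 0) fun j => by split_ifs <;> linarith
    have hsum : ∑ j, q j * (u j - 1 - if i = j then t else 0) = d - q i * t := by
      simp [mul_sub _ (_ - _), Finset.sum_sub_distrib, d]
    have hqt : q i * t = -|c - d| := by
      simp only [t]
      field_simp [hi.ne]
    linarith [le_abs_self (c - d)]
  refine ⟨hq, le_of_forall_pos_le_add fun ε hε => ?_⟩
  have hQ : 0 < ∑ i, q i + 1 := add_pos_of_nonneg_of_pos (Finset.sum_nonneg fun i _ => hq i) one_pos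
  have hz := h (fun i => u i - ε / (∑ i, q i + 1)) fun i => sub_lt_self _ (by positivity)
  simp only [mul_sub, Finset.sum_sub_distrib, ← Finset.sum_mul] at hz
  have : (∑ i, q i) * (ε / (∑ i, q i + 1)) ≤ ε := by
    rw [mul_div_assoc', div_le_iff₀ hQ]
    nlinarith
  linarith

/-- Gordan's alternative for concave functions, by separating the point `(v, …, v)` from the
open convex set of points strictly below a value of `(f i)ᵢ`. -/
lemma exists_mem_stdSimplex_forall_sum_mul_le [Fintype ι] (hf : ∀ i, ConcaveOn ℝ s (f i))
    (hs : s.Nonempty) {v : ℝ} (h : ∀ x ∈ s, ∃ i, f i x ≤ v) :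
    ∃ w ∈ stdSimplex ℝ ι, ∀ x ∈ s, ∑ i, w i * f i x ≤ v := by
  classical
  obtain ⟨x₀, hx₀⟩ := hs
  have : Nonempty ι := ⟨(h x₀ hx₀).choose⟩
  have hv : (fun _ => v) ∉ strictHypographImage s f := by
    simpa [mem_strictHypographImage] using h
  obtain ⟨p, hp⟩ := geometric_hahn_banach_open_point (convex_strictHypographImage hf)
    (isOpen_strictHypographImage s f) hv
  set q : ι → ℝ := fun i => p fun j => if i = j then 1 else 0
  have hp_apply (z : ι → ℝ) : p z = ∑ i, q i * z i := by
    simpa [q, mul_comm] using p.toLinearMap.pi_apply_eq_sum_univ z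
  have hlt {x : E} (hx : x ∈ s) {z : ι → ℝ} (hz : ∀ i, z i < f i x) :
      ∑ i, q i * z i < (∑ i, q i) * v := by
    simpa only [hp_apply, Finset.sum_mul] using hp z (mem_strictHypographImage.mpr ⟨x, hx, hz⟩)
  have hq : ∀ i, 0 ≤ q i := (nonneg_and_sum_mul_le_of_forall_lt fun _ => hlt hx₀).1
  have hQ : 0 < ∑ i, q i := by
    refine (Finset.sum_nonneg fun i _ => hq i).lt_of_ne' fun h0 => ?_
    have hq0 : ∀ i, q i = 0 := by simpa [Finset.sum_eq_zero_iff_of_nonneg, hq] using h0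
    simpa [hq0] using hlt hx₀ fun i => sub_one_lt (f i x₀)
  refine ⟨fun i => q i / ∑ j, q j,
    ⟨fun i => div_nonneg (hq i) hQ.le, by rw [← Finset.sum_div, div_self hQ.ne']⟩, fun x hx => ?_⟩
  have hle := (nonneg_and_sum_mul_le_of_forall_lt fun _ => hlt hx).2
  simp only [div_mul_eq_mul_div, ← Finset.sum_div]
  exact (div_le_iff₀' hQ).mpr hle

end Optimization

section Matrix

variable {𝕜 m n k : Type*} [RCLike 𝕜] [Fintype m]

lemma inner_toLp_col (A B : Matrix m n 𝕜) (i j : n) :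
    inner 𝕜 (WithLp.toLp 2 (A.col i)) (WithLp.toLp 2 (B.col j)) = (Aᴴ * B) i j := by
  simp [PiLp.inner_apply, Matrix.mul_apply, mul_comm]

lemma exists_isometry_col_eq [DecidableEq n] (e : n ↪ m) (N : Matrix m n 𝕜) (s : Set n)
    (hN : ∀ i ∈ s, ∀ j ∈ s, (Nᴴ * N) i j = if i = j then 1 else 0) :
    ∃ U : Matrix m n 𝕜, Uᴴ * U = 1 ∧ ∀ i ∈ s, U.col i = N.col i := by
  classical
  let v : m → EuclideanSpace 𝕜 m := Function.extend e (fun i => WithLp.toLp 2 (N.col i)) 0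
  have hv_apply (i : n) : v (e i) = WithLp.toLp 2 (N.col i) := e.injective.extend_apply _ _ i
  have hv : Orthonormal 𝕜 ((e '' s).domRestrict v) := by
    rw [orthonormal_iff_ite]
    rintro ⟨_, i, hi, rfl⟩ ⟨_, j, hj, rfl⟩
    change inner 𝕜 (v (e i)) (v (e j)) = _
    rw [hv_apply, hv_apply, inner_toLp_col, hN i hi j hj]
    exact if_congr (Subtype.mk_eq_mk.trans e.injective.eq_iff).symm rfl rfl
  obtain ⟨b, hb⟩ := hv.exists_orthonormalBasis_extension_of_card_eq (by simp)
  refine ⟨Matrix.of fun k i => b (e i) k, ?_, fun i hi => ?_⟩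
  · ext i j
    rw [← inner_toLp_col, one_apply]
    exact (orthonormal_iff_ite.mp b.orthonormal (e i) (e j)).trans (by simp)
  · have h := (hb (e i) ⟨i, hi, rfl⟩).trans (hv_apply i)
    ext k
    exact congrArg (fun x : EuclideanSpace 𝕜 m => x k) h

variable [Fintype n] [Fintype k]

open scoped MatrixOrder Matrix.Norms.L2Operator in
lemma exists_eq_conjTranspose_mul_self {A : Matrix n n 𝕜} (hA : A.PosSemidef) :
    ∃ B : Matrix n n 𝕜, A = Bᴴ * B := by
  classical exact CStarAlgebra.nonneg_iff_eq_star_mul_self.mp hA.nonneg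

open scoped MatrixOrder Matrix.Norms.L2Operator in
lemma exists_isUnit_eq_conjTranspose_mul_self [DecidableEq n] {A : Matrix n n 𝕜}
    (hA : A.PosDef) : ∃ B : Matrix n n 𝕜, IsUnit B ∧ A = Bᴴ * B :=
  CStarAlgebra.isStrictlyPositive_iff_eq_star_mul_self.mp (isStrictlyPositive_iff_posDef.mpr hA)

lemma trace_mul_nonneg {A B : Matrix n n 𝕜} (hA : A.PosSemidef) (hB : B.PosSemidef) :
    0 ≤ (A * B).trace := by
  obtain ⟨C, rfl⟩ := exists_eq_conjTranspose_mul_self hA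
  rw [Matrix.mul_assoc, trace_mul_comm]
  exact (hB.mul_mul_conjTranspose_same C).trace_nonneg

lemma trace_eq_trace_projection_add [DecidableEq n] {Q : Matrix n n 𝕜} (hQ : IsStarProjection Q)
    (S : Matrix n n 𝕜) :
    S.trace = (Q * S * Q).trace + ((1 - Q) * S * (1 - Q)).trace := by
  rw [trace_mul_cycle Q, trace_mul_cycle (1 - Q), hQ.isIdempotentElem.eq,
    hQ.one_sub.isIdempotentElem.eq, ← trace_add, ← Matrix.add_mul, add_sub_cancel,
    Matrix.one_mul]

lemma trace_projection_le {Q S : Matrix n n 𝕜} (hQ : IsStarProjection Q)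
    (hS : S.PosSemidef) : (Q * S * Q).trace ≤ S.trace := by
  classical
  have h := hS.conjTranspose_mul_mul_same (1 - Q)
  rw [← star_eq_conjTranspose, hQ.one_sub.isSelfAdjoint.star_eq] at h
  rw [trace_eq_trace_projection_add hQ S]
  exact le_add_of_nonneg_right h.trace_nonneg

lemma projection_eq_self_of_trace_eq {Q S : Matrix n n 𝕜}
    (hQ : IsStarProjection Q) (hS : S.PosSemidef) (h : (Q * S * Q).trace = S.trace) :
    Q * S * Q = S := by
  classical
  obtain ⟨B, rfl⟩ := exists_eq_conjTranspose_mul_self hS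
  have hQH : Qᴴ = Q := hQ.isSelfAdjoint
  have hzero : ((B * (1 - Q))ᴴ * (B * (1 - Q))).trace = 0 := by
    rw [trace_eq_trace_projection_add hQ (Bᴴ * B), left_eq_add] at h
    rw [← h, conjTranspose_mul, conjTranspose_sub, conjTranspose_one, hQH]
    simp only [Matrix.mul_assoc]
  have hB : B * Q = B := by
    rw [trace_conjTranspose_mul_self_eq_zero_iff, Matrix.mul_sub, Matrix.mul_one,
      sub_eq_zero] at hzero
    exact hzero.symm
  calc Q * (Bᴴ * B) * Q = (B * Q)ᴴ * (B * Q) := by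
        rw [conjTranspose_mul, hQH]; simp only [Matrix.mul_assoc]
    _ = Bᴴ * B := by rw [hB]

lemma isStarProjection_mul_conjTranspose [DecidableEq k] {V : Matrix n k 𝕜} (hV : Vᴴ * V = 1) :
    IsStarProjection (V * Vᴴ) where
  isIdempotentElem := by
    rw [IsIdempotentElem, Matrix.mul_assoc, ← Matrix.mul_assoc Vᴴ, hV, Matrix.one_mul]
  isSelfAdjoint := isHermitian_mul_conjTranspose_self V

lemma trace_conjTranspose_mul_mul_le [DecidableEq k] {V : Matrix n k 𝕜}
    {S : Matrix n n 𝕜} (hV : Vᴴ * V = 1) (hS : S.PosSemidef) :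
    (Vᴴ * S * V).trace ≤ S.trace := by
  have hQ := isStarProjection_mul_conjTranspose hV
  have htr : (V * Vᴴ * S * (V * Vᴴ)).trace = (Vᴴ * S * V).trace := by
    rw [trace_mul_cycle, hQ.isIdempotentElem.eq, Matrix.mul_assoc, trace_mul_comm]
  exact htr ▸ trace_projection_le hQ hS

lemma exists_isometry_mul_diagonal [DecidableEq n] (e : n ↪ m) {W : Matrix m n 𝕜} {σ : n → ℝ}
    (hW : Wᴴ * W = diagonal fun i => ((σ i ^ 2 : ℝ) : 𝕜)) :
    ∃ U : Matrix m n 𝕜, Uᴴ * U = 1 ∧ W = U * diagonal fun i => (σ i : 𝕜) := by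
  have hN : ∀ i ∈ {i | σ i ≠ 0}, ∀ j ∈ {i | σ i ≠ 0},
      ((W * diagonal fun i => (σ i : 𝕜)⁻¹)ᴴ * (W * diagonal fun i => (σ i : 𝕜)⁻¹)) i j =
        if i = j then 1 else 0 := by
    intro i hi j _
    have hi : (σ i : 𝕜) ≠ 0 := RCLike.ofReal_ne_zero.mpr hi
    rw [conjTranspose_mul, diagonal_conjTranspose, Matrix.mul_assoc, ← Matrix.mul_assoc Wᴴ, hW,
      diagonal_mul_diagonal, diagonal_mul_diagonal, diagonal_apply]
    refine if_congr Iff.rfl ?_ rfl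
    simp only [Pi.star_apply, star_inv₀, RCLike.star_def, RCLike.conj_ofReal, map_pow]
    field_simp
  obtain ⟨U, hU, hUcol⟩ := exists_isometry_col_eq e _ _ hN
  refine ⟨U, hU, ?_⟩
  ext k i
  rw [mul_diagonal]
  by_cases hi : σ i = 0
  · have hcol : WithLp.toLp 2 (W.col i) = 0 := by
      rw [← inner_self_eq_zero (𝕜 := 𝕜), inner_toLp_col, hW]
      simp [hi]
    simpa [hi] using congrArg (fun x : EuclideanSpace 𝕜 m => x k) hcol
  · have hUW : U k i = W k i * (σ i : 𝕜)⁻¹ := by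
      simpa [mul_diagonal] using congrFun (hUcol i hi) k
    rw [hUW, inv_mul_cancel_right₀ (RCLike.ofReal_ne_zero.mpr hi)]

lemma exists_svd_of_embedding [DecidableEq n] (e : n ↪ m) (H : Matrix m n 𝕜) :
    ∃ (U : Matrix m n 𝕜) (V : Matrix n n 𝕜) (σ : n → ℝ), Uᴴ * U = 1 ∧ Vᴴ * V = 1 ∧
      (∀ i, 0 ≤ σ i) ∧ H = U * diagonal (fun i => (σ i : 𝕜)) * Vᴴ := by
  have hH := isHermitian_conjTranspose_mul_self H
  set V : Matrix n n 𝕜 := hH.eigenvectorUnitary.1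
  have hV : Vᴴ * V = 1 := Unitary.coe_star_mul_self hH.eigenvectorUnitary
  have hV' : V * Vᴴ = 1 := Unitary.coe_mul_star_self hH.eigenvectorUnitary
  have hspec : Hᴴ * H = V * diagonal (fun i => (hH.eigenvalues i : 𝕜)) * Vᴴ :=
    hH.spectral_theorem
  have hHV : (H * V)ᴴ * (H * V) = diagonal fun i => ((√(hH.eigenvalues i) ^ 2 : ℝ) : 𝕜) :=
    calc (H * V)ᴴ * (H * V) = Vᴴ * (Hᴴ * H) * V := by
          rw [conjTranspose_mul]; simp only [Matrix.mul_assoc]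
      _ = Vᴴ * (V * diagonal (fun i => (hH.eigenvalues i : 𝕜)) * Vᴴ) * V :=
          congrArg (Vᴴ * · * V) hspec
      _ = Vᴴ * V * diagonal (fun i => (hH.eigenvalues i : 𝕜)) * (Vᴴ * V) := by
          simp only [Matrix.mul_assoc]
      _ = _ := by
          simp only [hV, Matrix.one_mul, Matrix.mul_one,
            Real.sq_sqrt (eigenvalues_conjTranspose_mul_self_nonneg H _)]
  obtain ⟨U, hU, hHU⟩ := exists_isometry_mul_diagonal e hHV
  refine ⟨U, V, fun i => √(hH.eigenvalues i), hU, hV, fun i => Real.sqrt_nonneg _, ?_⟩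
  rw [← hHU, Matrix.mul_assoc, hV', Matrix.mul_one]

lemma exists_thin_svd {m n : ℕ} (H : Matrix (Fin m) (Fin n) 𝕜) :
    ∃ (U : Matrix (Fin m) (Fin (min n m)) 𝕜) (V : Matrix (Fin n) (Fin (min n m)) 𝕜)
      (σ : Fin (min n m) → ℝ), Uᴴ * U = 1 ∧ Vᴴ * V = 1 ∧ (∀ i, 0 ≤ σ i) ∧
        H = U * diagonal (fun i => (σ i : 𝕜)) * Vᴴ := by
  rcases le_total n m with h | h
  · rw [min_eq_left h]
    exact exists_svd_of_embedding (Fin.castLEEmb h) H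
  · rw [min_eq_right h]
    obtain ⟨U, V, σ, hU, hV, hσ, hH⟩ := exists_svd_of_embedding (Fin.castLEEmb h) Hᴴ
    refine ⟨V, U, σ, hV, hU, hσ, ?_⟩
    have hσH : (diagonal fun i => (σ i : 𝕜))ᴴ = diagonal fun i => (σ i : 𝕜) :=
      isHermitian_diagonal_iff.mpr fun i => RCLike.conj_ofReal _
    rw [← conjTranspose_conjTranspose H, hH, conjTranspose_mul, conjTranspose_mul, hσH,
      conjTranspose_conjTranspose, Matrix.mul_assoc]

lemma exists_generalized_inverse {m n : ℕ} (H : Matrix (Fin m) (Fin n) 𝕜) :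
    ∃ K : Matrix (Fin n) (Fin m) 𝕜, H * K * H = H ∧ IsStarProjection (K * H) := by
  obtain ⟨U, V, σ, hU, hV, -, rfl⟩ := exists_thin_svd H
  set D := diagonal fun i => (σ i : 𝕜)
  set D' := diagonal fun i => (σ i : 𝕜)⁻¹
  have hKH : V * D' * Uᴴ * (U * D * Vᴴ) = V * (D' * D) * Vᴴ :=
    calc _ = V * D' * (Uᴴ * U) * D * Vᴴ := by simp only [Matrix.mul_assoc]
      _ = _ := by rw [hU, Matrix.mul_one]; simp only [Matrix.mul_assoc]
  have hH : U * D * Vᴴ * (V * D' * Uᴴ) * (U * D * Vᴴ) = U * D * Vᴴ :=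
    calc _ = U * D * (Vᴴ * V) * (D' * D) * Vᴴ := by
          rw [Matrix.mul_assoc, hKH]; simp only [Matrix.mul_assoc]
      _ = U * (D * D' * D) * Vᴴ := by
          rw [hV, Matrix.mul_one]; simp only [Matrix.mul_assoc]
      _ = _ := by simp [D, D', diagonal_mul_diagonal]
  refine ⟨V * D' * Uᴴ, hH, ?_, ?_⟩
  · rw [IsIdempotentElem, Matrix.mul_assoc, ← Matrix.mul_assoc (U * D * Vᴴ), hH]
  · have hD : (D' * D).IsHermitian := by
      rw [diagonal_mul_diagonal, isHermitian_diagonal_iff]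
      exact fun i => by simp [isSelfAdjoint_iff]
    rw [hKH]
    exact isHermitian_mul_mul_conjTranspose V hD

end Matrix

section LogDet

variable {m : ℕ} {X Y : Matrix (Fin m) (Fin m) ℂ}

lemma logDet_one : logDet (1 : Matrix (Fin m) (Fin m) ℂ) = 0 := by simp [logDet]

lemma logDet_mul (hX : 0 < X.det) (hY : 0 < Y.det) : logDet (X * Y) = logDet X + logDet Y := by
  obtain ⟨hX, hX'⟩ := Complex.pos_iff.mp hX
  obtain ⟨hY, -⟩ := Complex.pos_iff.mp hY
  rw [logDet, logDet, logDet, det_mul, Complex.mul_re, ← hX', zero_mul, sub_zero,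
    Real.log_mul hX.ne' hY.ne']

lemma logDet_inv_mul (hX : X.PosDef) (hY : 0 < Y.det) :
    logDet (X⁻¹ * Y) = logDet Y - logDet X := by
  have hX' : IsUnit X.det := (isUnit_iff_isUnit_det X).mp hX.isUnit
  have h := logDet_mul hX.det_pos hX.inv.det_pos
  rw [mul_nonsing_inv X hX', logDet_one] at h
  rw [logDet_mul hX.inv.det_pos hY]
  linarith

lemma logDet_eq_sum_log_eigenvalues (hX : X.PosDef) :
    logDet X = ∑ i, Real.log (hX.isHermitian.eigenvalues i) := by
  rw [← Real.log_prod fun i _ => (hX.eigenvalues_pos i).ne', logDet,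
    hX.isHermitian.det_eq_prod_eigenvalues]
  norm_cast

lemma logDet_lt_trace_sub (hX : X.PosDef) (hne : X ≠ 1) : logDet X < X.trace.re - m := by
  have hev : ∃ i, hX.isHermitian.eigenvalues i ≠ 1 := by
    by_contra! h
    refine hne ?_
    have hd : (RCLike.ofReal ∘ hX.isHermitian.eigenvalues : Fin m → ℂ) = fun _ => 1 := by
      funext i
      simp [h i]
    rw [hX.isHermitian.spectral_theorem, hd, diagonal_one, map_one]
  obtain ⟨i, hi⟩ := hev
  have htr : X.trace.re - m = ∑ i, (hX.isHermitian.eigenvalues i - 1) := by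
    simp [hX.isHermitian.trace_eq_sum_eigenvalues]
  rw [logDet_eq_sum_log_eigenvalues hX, htr]
  exact Finset.sum_lt_sum (fun j _ => Real.log_le_sub_one_of_pos (hX.eigenvalues_pos j))
    ⟨i, Finset.mem_univ i, Real.log_lt_sub_one_of_pos (hX.eigenvalues_pos i) hi⟩

/-- The graph of the strictly concave function `log |·|` lies below its tangent at `X`; the case
`X = 1` is `logDet_lt_trace_sub`, to which a congruence reduces the general case. -/
lemma logDet_lt_add_trace (hX : X.PosDef) (hY : Y.PosDef) (hne : Y ≠ X) :
    logDet Y < logDet X + ((X⁻¹ * Y).trace.re - m) := by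
  have hX' : IsUnit X.det := (isUnit_iff_isUnit_det X).mp hX.isUnit
  obtain ⟨B, hB, hXB⟩ := exists_isUnit_eq_conjTranspose_mul_self hX.inv
  have hZ : (B * Y * Bᴴ).PosDef := hB.posDef_star_right_conjugate_iff.mpr hY
  have hlog : logDet (B * Y * Bᴴ) = logDet Y - logDet X := by
    rw [← logDet_inv_mul hX hY.det_pos, hXB, logDet, logDet, Matrix.mul_assoc, det_mul_comm,
      Matrix.mul_assoc, det_mul_comm]
  have htr : (B * Y * Bᴴ).trace = (X⁻¹ * Y).trace := by
    rw [hXB, trace_mul_cycle]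
  have hZ1 : B * Y * Bᴴ ≠ 1 := fun h => hne <|
    have hYB : Y * X⁻¹ = 1 := by
      rw [hXB, ← Matrix.mul_assoc]
      exact mul_eq_one_comm.mp ((Matrix.mul_assoc B Y Bᴴ).symm.trans h)
    left_inv_eq_right_inv hYB (nonsing_inv_mul X hX')
  have := logDet_lt_trace_sub hZ hZ1
  rw [hlog, htr] at this
  linarith

lemma logDet_le_add_trace (hX : X.PosDef) (hY : Y.PosDef) :
    logDet Y ≤ logDet X + ((X⁻¹ * Y).trace.re - m) := by
  rcases eq_or_ne Y X with rfl | hne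
  · rw [nonsing_inv_mul _ ((isUnit_iff_isUnit_det Y).mp hX.isUnit)]
    simp
  · exact (logDet_lt_add_trace hX hY hne).le

lemma strictConcaveOn_logDet :
    StrictConcaveOn ℝ {X : Matrix (Fin m) (Fin m) ℂ | X.PosDef} logDet := by
  have hmem {X Y : Matrix (Fin m) (Fin m) ℂ} (hX : X.PosDef) (hY : Y.PosDef) {a b : ℝ}
      (ha : 0 < a) (hb : 0 < b) : (a • X + b • Y).PosDef := (hX.smul ha).add (hY.smul hb)
  refine ⟨convex_iff_forall_pos.mpr fun X hX Y hY a b ha hb _ => hmem hX hY ha hb, ?_⟩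
  intro X hX Y hY hne a b ha hb hab
  set Z := a • X + b • Y with hZ_def
  have hZ : Z.PosDef := hmem hX hY ha hb
  have hXZ : X ≠ Z := fun h => hne <| smul_right_injective _ hb.ne' <| by
    have : (a + b) • X = a • X + b • Y := by rw [hab, one_smul, ← hZ_def, ← h]
    simpa only [add_smul, add_right_inj] using this
  have htr : a * (Z⁻¹ * X).trace.re + b * (Z⁻¹ * Y).trace.re = m := by
    have h : (Z⁻¹ * Z).trace.re = m := by
      rw [nonsing_inv_mul Z ((isUnit_iff_isUnit_det Z).mp hZ.isUnit)]
      simp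
    simpa [hZ_def, Matrix.mul_add] using h
  have hX := mul_lt_mul_of_pos_left (logDet_lt_add_trace hZ hX hXZ) ha
  have hY := mul_le_mul_of_nonneg_left (logDet_le_add_trace hZ hY) hb.le
  simp only [smul_eq_mul]
  obtain rfl : b = 1 - a := by linarith
  linarith

open scoped MatrixOrder in
lemma strictMonoOn_logDet :
    StrictMonoOn logDet {X : Matrix (Fin m) (Fin m) ℂ | X.PosDef} := by
  intro X hX Y hY hlt
  have hYu : IsUnit Y.det := (isUnit_iff_isUnit_det Y).mp hY.isUnit
  have htr := trace_mul_nonneg hY.inv.posSemidef (Matrix.le_iff.mp hlt.le)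
  rw [Matrix.mul_sub, nonsing_inv_mul Y hYu, trace_sub, trace_one, sub_nonneg] at htr
  have htr' : (Y⁻¹ * X).trace.re ≤ m := by simpa using (Complex.le_def.mp htr).1
  linarith [logDet_lt_add_trace hY hX hlt.ne]

/-- Hadamard's inequality. -/
lemma logDet_le_sum_log_diag (hX : X.PosDef) : logDet X ≤ ∑ i, Real.log (X i i).re := by
  have hpos (i : Fin m) : 0 < (X i i).re := (Complex.pos_iff.mp hX.diag_pos).1
  have hre (i : Fin m) : X i i = (X i i).re :=
    Complex.ext rfl (Complex.pos_iff.mp hX.diag_pos).2.symm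
  set D := diagonal fun i => X i i with hD_def
  have hD : D.PosDef := PosDef.diagonal fun i => hX.diag_pos
  have htr : (D⁻¹ * X).trace = m := by
    have hDD : D⁻¹ = diagonal fun i => (X i i)⁻¹ := by
      refine inv_eq_left_inv ?_
      rw [hD_def, diagonal_mul_diagonal, ← diagonal_one]
      exact congrArg diagonal (funext fun i => inv_mul_cancel₀ hX.diag_pos.ne')
    simp [hDD, trace, inv_mul_cancel₀ hX.diag_pos.ne']
  have hlog : logDet D = ∑ i, Real.log (X i i).re := by
    rw [logDet, det_diagonal, Finset.prod_congr rfl fun i _ => hre i, ← Complex.ofReal_prod,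
      Complex.ofReal_re, Real.log_prod fun i _ => (hpos i).ne']
  simpa [htr, hlog] using logDet_le_add_trace hD hX

end LogDet

section Feasible

variable {m n : ℕ} {P : ℝ}

/-- `rx H` as a real linear map. -/
def rxLinearMap (H : Matrix (Fin m) (Fin n) ℂ) :
    Matrix (Fin n) (Fin n) ℂ →ₗ[ℝ] Matrix (Fin m) (Fin m) ℂ where
  toFun := rx H
  map_add' S T := by simp only [rx, Matrix.mul_add, Matrix.add_mul]
  map_smul' a S := by simp only [rx, Matrix.mul_smul, Matrix.smul_mul, RingHom.id_apply]

lemma rx_posSemidef (H : Matrix (Fin m) (Fin n) ℂ) {S : Matrix (Fin n) (Fin n) ℂ}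
    (hS : S.PosSemidef) : (rx H S).PosSemidef :=
  hS.mul_mul_conjTranspose_same H

lemma convex_posSemidef : Convex ℝ {S : Matrix (Fin n) (Fin n) ℂ | S.PosSemidef} :=
  fun _ hS _ hT _ _ ha hb _ => (hS.smul ha).add (hT.smul hb)

lemma convex_feasible (n : ℕ) (P : ℝ) : Convex ℝ (feasible n P) := by
  refine convex_posSemidef.inter fun S (hS : S.trace.re ≤ P) T (hT : T.trace.re ≤ P)
    a b ha hb hab => ?_
  change (a • S + b • T).trace.re ≤ P
  calc (a • S + b • T).trace.re = a * S.trace.re + b * T.trace.re := by simp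
    _ ≤ a * P + b * P := by gcongr
    _ = P := by rw [← add_mul, hab, one_mul]

lemma nonempty_feasible (n : ℕ) (hP : 0 ≤ P) : (feasible n P).Nonempty :=
  ⟨0, PosSemidef.zero, by simpa using hP⟩

open scoped Matrix.Norms.Frobenius in
lemma trace_conjTranspose_mul_self_re_eq_norm_sq (B : Matrix (Fin m) (Fin n) ℂ) :
    (Bᴴ * B).trace.re = ‖B‖ ^ 2 := by
  rw [frobenius_norm_def, ← Real.sqrt_eq_rpow, Real.sq_sqrt (by positivity), Finset.sum_comm]
  simp [trace, Matrix.mul_apply, ← Complex.normSq_eq_conj_mul_self, Complex.sq_norm]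

open scoped Matrix.Norms.Frobenius in
lemma isCompact_feasible (n : ℕ) (hP : 0 ≤ P) : IsCompact (feasible n P) := by
  have himage : feasible n P =
      (fun B : Matrix (Fin n) (Fin n) ℂ => Bᴴ * B) '' Metric.closedBall 0 √P := by
    ext S
    simp only [Set.mem_image, mem_closedBall_zero_iff, Real.le_sqrt (norm_nonneg _) hP,
      ← trace_conjTranspose_mul_self_re_eq_norm_sq]
    constructor
    · rintro ⟨hS, htr⟩
      obtain ⟨B, rfl⟩ := exists_eq_conjTranspose_mul_self hS
      exact ⟨B, htr, rfl⟩
    · rintro ⟨B, htr, rfl⟩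
      exact ⟨posSemidef_conjTranspose_mul_self B, htr⟩
  have : ProperSpace (Matrix (Fin n) (Fin n) ℂ) := FiniteDimensional.proper ℂ _
  rw [himage]
  exact (isCompact_closedBall 0 √P).image (by fun_prop)

variable {H : Matrix (Fin m) (Fin n) ℂ} {φ : Matrix (Fin m) (Fin m) ℂ → ℝ}
  {S T : Matrix (Fin n) (Fin n) ℂ}

open scoped MatrixOrder

lemma rx_lt_rx_add_smul_one (hH : H ≠ 0) (S : Matrix (Fin n) (Fin n) ℂ) {ε : ℝ} (hε : 0 < ε) :
    rx H S < rx H (S + ε • 1) := by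
  have hrx : rx H (S + ε • 1) = rx H S + ε • (H * Hᴴ) := by
    simp [rx, Matrix.mul_add, Matrix.add_mul]
  have hnonneg : 0 ≤ ε • (H * Hᴴ) := ((posSemidef_self_mul_conjTranspose H).smul hε.le).nonneg
  have hne : ε • (H * Hᴴ) ≠ 0 :=
    smul_ne_zero hε.ne' (self_mul_conjTranspose_eq_zero.not.mpr hH)
  rw [hrx]
  exact lt_add_of_pos_right _ (hnonneg.lt_of_ne' hne)

lemma trace_eq_of_isMaxOn (hH : H ≠ 0)
    (hφ : StrictMonoOn φ {R : Matrix (Fin m) (Fin m) ℂ | R.PosSemidef}) (hS : S ∈ feasible n P)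
    (hmax : IsMaxOn (fun X => φ (rx H X)) (feasible n P) S) : S.trace.re = P := by
  by_contra hne
  have hlt : 0 < P - S.trace.re := sub_pos.mpr (lt_of_le_of_ne hS.2 hne)
  set ε : ℝ := (P - S.trace.re) / (n + 1)
  have hε : 0 < ε := by positivity
  have hεn : ε * n ≤ P - S.trace.re := by
    rw [div_mul_eq_mul_div, div_le_iff₀ (by positivity)]
    nlinarith
  have hT : (S + ε • 1).PosSemidef := hS.1.add (PosSemidef.one.smul hε.le)
  have htr : (S + ε • (1 : Matrix (Fin n) (Fin n) ℂ)).trace.re ≤ P := by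
    simp only [trace_add, trace_smul, trace_one, Complex.add_re, Complex.smul_re]
    simpa using by linarith
  exact (hφ (rx_posSemidef H hS.1) (rx_posSemidef H hT) (rx_lt_rx_add_smul_one hH S hε)).not_ge
    (isMaxOn_iff.mp hmax _ ⟨hT, htr⟩)

lemma rx_eq_of_isMaxOn
    (hφ : StrictConcaveOn ℝ {R : Matrix (Fin m) (Fin m) ℂ | R.PosSemidef} φ)
    (hS : S ∈ feasible n P) (hT : T ∈ feasible n P)
    (hSmax : IsMaxOn (fun X => φ (rx H X)) (feasible n P) S)
    (hTmax : IsMaxOn (fun X => φ (rx H X)) (feasible n P) T) : rx H S = rx H T := by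
  have himage : Convex ℝ (rx H '' feasible n P) :=
    (convex_feasible n P).linear_image (rxLinearMap H)
  have hsub : rx H '' feasible n P ⊆ {R : Matrix (Fin m) (Fin m) ℂ | R.PosSemidef} := by
    rintro _ ⟨X, hX, rfl⟩
    exact rx_posSemidef H hX.1
  refine (hφ.subset hsub himage).eq_of_isMaxOn ?_ ?_ (Set.mem_image_of_mem _ hS)
    (Set.mem_image_of_mem _ hT) <;>
  · rintro _ ⟨X, hX, rfl⟩
    first | exact hSmax hX | exact hTmax hX

/-- The part of a maximizer supported on the kernel of `H` would waste power, so the maximizer is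
determined by the received covariance. -/
lemma eq_of_isMaxOn (hH : H ≠ 0)
    (hmono : StrictMonoOn φ {R : Matrix (Fin m) (Fin m) ℂ | R.PosSemidef})
    (hconc : StrictConcaveOn ℝ {R : Matrix (Fin m) (Fin m) ℂ | R.PosSemidef} φ)
    (hS : S ∈ feasible n P) (hT : T ∈ feasible n P)
    (hSmax : IsMaxOn (fun X => φ (rx H X)) (feasible n P) S)
    (hTmax : IsMaxOn (fun X => φ (rx H X)) (feasible n P) T) : S = T := by
  obtain ⟨K, hHK, hKH⟩ := exists_generalized_inverse H
  suffices h : ∀ X ∈ feasible n P, IsMaxOn (fun X => φ (rx H X)) (feasible n P) X →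
      K * rx H X * Kᴴ = X by
    rw [← h S hS hSmax, ← h T hT hTmax, rx_eq_of_isMaxOn hconc hS hT hSmax hTmax]
  intro X hX hXmax
  set Q := K * H
  have hQ : Qᴴ = Q := hKH.isSelfAdjoint
  have hHQ : H * Q = H := by rw [← Matrix.mul_assoc, hHK]
  have hKX : K * rx H X * Kᴴ = Q * X * Q :=
    calc K * rx H X * Kᴴ = Q * X * Qᴴ := by
          simp only [rx, Q, conjTranspose_mul, Matrix.mul_assoc]
      _ = Q * X * Q := by rw [hQ]
  have hrx : rx H (Q * X * Q) = rx H X :=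
    calc rx H (Q * X * Q) = H * Q * X * (H * Qᴴ)ᴴ := by
          simp only [rx, conjTranspose_mul, conjTranspose_conjTranspose, Matrix.mul_assoc]
      _ = rx H X := by rw [hQ, hHQ, rx]
  have hmem : Q * X * Q ∈ feasible n P := by
    refine ⟨?_, (Complex.le_def.mp (trace_projection_le hKH hX.1)).1.trans hX.2⟩
    simpa only [hQ] using hX.1.mul_mul_conjTranspose_same Q
  have hmax : IsMaxOn (fun X => φ (rx H X)) (feasible n P) (Q * X * Q) := by
    simpa only [isMaxOn_iff, hrx] using hXmax
  rw [hKX]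
  refine projection_eq_self_of_trace_eq hKH hX.1 (Complex.ext ?_ ?_)
  · rw [trace_eq_of_isMaxOn hH hmono hX hXmax, trace_eq_of_isMaxOn hH hmono hmem hmax]
  · rw [← (Complex.nonneg_iff.mp hX.1.trace_nonneg).2,
      ← (Complex.nonneg_iff.mp hmem.1.trace_nonneg).2]

end Feasible

section LogDetAdd

variable {m n : ℕ} {M : Matrix (Fin m) (Fin m) ℂ}

lemma strictConcaveOn_logDet_add (hM : M.PosDef) :
    StrictConcaveOn ℝ {R : Matrix (Fin m) (Fin m) ℂ | R.PosSemidef} fun R => logDet (M + R) :=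
  (strictConcaveOn_logDet.translate_right M).subset (fun _ hR => hM.add_posSemidef hR)
    convex_posSemidef

open scoped MatrixOrder in
lemma strictMonoOn_logDet_add (hM : M.PosDef) :
    StrictMonoOn (fun R => logDet (M + R)) {R : Matrix (Fin m) (Fin m) ℂ | R.PosSemidef} :=
  fun _ hR _ hR' hlt => strictMonoOn_logDet (hM.add_posSemidef hR) (hM.add_posSemidef hR')
    (add_lt_add_right hlt M)

lemma concaveOn_logDet_add_rx (hM : M.PosDef) (H : Matrix (Fin m) (Fin n) ℂ) (P : ℝ) :
    ConcaveOn ℝ (feasible n P) fun S => logDet (M + rx H S) :=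
  ((strictConcaveOn_logDet_add hM).concaveOn.comp_linearMap (rxLinearMap H)).subset
    (fun _ hS => rx_posSemidef H hS.1) (convex_feasible n P)

lemma continuousOn_logDet_add_rx (hM : M.PosDef) (H : Matrix (Fin m) (Fin n) ℂ) (P : ℝ) :
    ContinuousOn (fun S => logDet (M + rx H S)) (feasible n P) := by
  have hdet : Continuous fun S : Matrix (Fin n) (Fin n) ℂ => (M + rx H S).det.re := by
    refine Complex.continuous_re.comp (Continuous.matrix_det ?_)
    unfold rx
    fun_prop
  refine hdet.continuousOn.log fun S hS => ne_of_gt ?_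
  exact (Complex.pos_iff.mp (hM.add_posSemidef (rx_posSemidef H hS.1)).det_pos).1

end LogDetAdd

section ConvexCombination

variable {μ : ℝ}

lemma convex_combination_lt (h0 : 0 ≤ μ) (h1 : μ ≤ 1) {x y x' y' : ℝ} (hxy : x < y)
    (hxy' : x' < y') : μ * x + (1 - μ) * x' < μ * y + (1 - μ) * y' := by
  rcases h0.eq_or_lt with rfl | h0
  · simpa
  · nlinarith

variable {E : Type*} {f g : E → ℝ} {s : Set E}

lemma strictMonoOn_convex_combination [Preorder E] (h0 : 0 ≤ μ) (h1 : μ ≤ 1)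
    (hf : StrictMonoOn f s) (hg : StrictMonoOn g s) :
    StrictMonoOn (fun x => μ * f x + (1 - μ) * g x) s :=
  fun _ hx _ hy hxy => convex_combination_lt h0 h1 (hf hx hy hxy) (hg hx hy hxy)

lemma strictConcaveOn_convex_combination [AddCommMonoid E] [Module ℝ E] (h0 : 0 ≤ μ)
    (h1 : μ ≤ 1) (hf : StrictConcaveOn ℝ s f) (hg : StrictConcaveOn ℝ s g) :
    StrictConcaveOn ℝ s fun x => μ * f x + (1 - μ) * g x := by
  refine ⟨hf.1, fun x hx y hy hne a b ha hb hab => ?_⟩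
  refine lt_of_eq_of_lt ?_
    (convex_combination_lt h0 h1 (hf.2 hx hy hne ha hb hab) (hg.2 hx hy hne ha hb hab))
  simp only [smul_eq_mul]
  ring

end ConvexCombination

section WaterFilling

lemma waterPower_nonneg (μ σ : ℝ) : 0 ≤ waterPower μ σ := by
  unfold waterPower
  split_ifs
  · exact le_rfl
  · exact le_max_right _ _

lemma waterPower_eq_zero_of_nonpos {μ : ℝ} (hμ : μ ≤ 0) (σ : ℝ) : waterPower μ σ = 0 := by
  unfold waterPower
  split_ifs
  · rfl
  · exact max_eq_right (by linarith [show 0 ≤ 1 / σ ^ 2 by positivity])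

lemma exists_sum_waterPower_eq {ι : Type*} [Fintype ι] {σ : ι → ℝ} {i₀ : ι} (hi₀ : σ i₀ ≠ 0)
    {P : ℝ} (hP : 0 ≤ P) : ∃ μ, ∑ i, waterPower μ (σ i) = P := by
  have hcont : Continuous fun μ => ∑ i, waterPower μ (σ i) := by
    refine continuous_finsetSum _ fun i _ => ?_
    unfold waterPower
    split_ifs <;> fun_prop
  have hzero : ∑ i, waterPower 0 (σ i) = 0 :=
    Finset.sum_eq_zero fun i _ => waterPower_eq_zero_of_nonpos le_rfl (σ i)
  set M := P + 1 / σ i₀ ^ 2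
  have hle : P ≤ ∑ i, waterPower M (σ i) :=
    calc P ≤ waterPower M (σ i₀) := by simp [waterPower, hi₀, M]
      _ ≤ ∑ i, waterPower M (σ i) :=
        Finset.single_le_sum (fun i _ => waterPower_nonneg M (σ i)) (Finset.mem_univ i₀)
  have hM : 0 ≤ M := by positivity
  obtain ⟨μ, -, hμ⟩ := intermediate_value_Icc hM hcont.continuousOn ⟨hzero.trans_le hP, hle⟩
  exact ⟨μ, hμ⟩

/-- The tangent of `x ↦ log (1 + σ² x)` at the water-filling power has slope `1/μ`, or smaller than
that if the power is zero. -/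
lemma log_one_add_mul_le_waterPower {μ : ℝ} (hμ : 0 < μ) (σ : ℝ) {x : ℝ} (hx : 0 ≤ x) :
    Real.log (1 + σ ^ 2 * x) ≤
      Real.log (1 + σ ^ 2 * waterPower μ σ) + (x - waterPower μ σ) / μ := by
  rcases eq_or_ne σ 0 with rfl | hσ
  · simpa [waterPower] using div_nonneg hx hμ.le
  have hσ2 : 0 < σ ^ 2 := by positivity
  have hx1 : 0 < 1 + σ ^ 2 * x := by positivity
  rw [waterPower, if_neg hσ]
  rcases le_total (μ - 1 / σ ^ 2) 0 with hle | hge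
  · rw [max_eq_right hle]
    have hσμ : σ ^ 2 ≤ 1 / μ := (le_one_div hσ2 hμ).mpr (by linarith)
    calc Real.log (1 + σ ^ 2 * x) ≤ σ ^ 2 * x := by
          linarith [Real.log_le_sub_one_of_pos hx1]
      _ ≤ 1 / μ * x := by gcongr
      _ = Real.log (1 + σ ^ 2 * 0) + (x - 0) / μ := by
          rw [mul_zero, add_zero, Real.log_one]; ring
  · rw [max_eq_left hge]
    have hlevel : 1 + σ ^ 2 * (μ - 1 / σ ^ 2) = σ ^ 2 * μ := by field_simp; ring
    have hlog := Real.log_le_sub_one_of_pos (div_pos hx1 (mul_pos hσ2 hμ))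
    rw [Real.log_div hx1.ne' (by positivity)] at hlog
    have hslope : (1 + σ ^ 2 * x) / (σ ^ 2 * μ) - 1 = (x - (μ - 1 / σ ^ 2)) / μ := by
      field_simp
      ring
    rw [hlevel, ← hslope]
    linarith

variable {m n k : ℕ}

lemma exists_isWaterFilling {H : Matrix (Fin m) (Fin n) ℂ} (hH : H ≠ 0) {P : ℝ} (hP : 0 ≤ P) :
    ∃ S r, IsWaterFilling H P S r := by
  obtain ⟨U, V, σ, hU, hV, hσ, hUV⟩ := exists_thin_svd H
  have hne : ∃ i, σ i ≠ 0 := by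
    by_contra! h0
    exact hH (by simp [hUV, h0])
  obtain ⟨i₀, hi₀⟩ := hne
  obtain ⟨μ, hμ⟩ := exists_sum_waterPower_eq hi₀ hP
  exact ⟨_, _, U, V, σ, μ, hU, hV, hσ, hUV, hμ, rfl, rfl⟩

section ThinSVD

variable {U : Matrix (Fin m) (Fin k) ℂ} {V : Matrix (Fin n) (Fin k) ℂ} {σ : Fin k → ℝ}

lemma logDet_one_add_rx_svd (hU : Uᴴ * U = 1) (T : Matrix (Fin n) (Fin n) ℂ) :
    logDet (1 + rx (U * diagonal (fun i => (σ i : ℂ)) * Vᴴ) T) =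
      logDet (1 + diagonal (fun i => (σ i : ℂ)) * (Vᴴ * T * V) * diagonal fun i => (σ i : ℂ)) := by
  set D : Matrix (Fin k) (Fin k) ℂ := diagonal fun i => (σ i : ℂ)
  have hD : Dᴴ = D := by simp [D, diagonal_conjTranspose, Pi.star_def]
  have hrx : rx (U * D * Vᴴ) T = U * (D * (Vᴴ * T * V) * D * Uᴴ) := by
    simp only [rx, conjTranspose_mul, conjTranspose_conjTranspose, hD, Matrix.mul_assoc]
  rw [hrx, logDet, det_one_add_mul_comm, Matrix.mul_assoc _ Uᴴ, hU, Matrix.mul_one, logDet]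

lemma logDet_one_add_rx_svd_le (hU : Uᴴ * U = 1) {T : Matrix (Fin n) (Fin n) ℂ}
    (hT : T.PosSemidef) :
    logDet (1 + rx (U * diagonal (fun i => (σ i : ℂ)) * Vᴴ) T) ≤
      ∑ i, Real.log (1 + σ i ^ 2 * ((Vᴴ * T * V) i i).re) := by
  set D : Matrix (Fin k) (Fin k) ℂ := diagonal fun i => (σ i : ℂ)
  have hD : Dᴴ = D := by simp [D, diagonal_conjTranspose, Pi.star_def]
  have hpos : (1 + D * (Vᴴ * T * V) * D).PosDef := by
    refine PosDef.one.add_posSemidef ?_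
    simpa only [hD] using (hT.conjTranspose_mul_mul_same V).mul_mul_conjTranspose_same D
  rw [logDet_one_add_rx_svd hU]
  refine (logDet_le_sum_log_diag hpos).trans_eq (Finset.sum_congr rfl fun i _ => ?_)
  simp [D, pow_two, mul_right_comm]

lemma conjTranspose_mul_conj_diagonal_mul (hV : Vᴴ * V = 1) (p : Fin k → ℂ) :
    Vᴴ * (V * diagonal p * Vᴴ) * V = diagonal p :=
  calc Vᴴ * (V * diagonal p * Vᴴ) * V = Vᴴ * V * diagonal p * (Vᴴ * V) := by
        simp only [Matrix.mul_assoc]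
    _ = diagonal p := by rw [hV, Matrix.one_mul, Matrix.mul_one]

lemma logDet_one_add_rx_svd_diagonal (hU : Uᴴ * U = 1) (hV : Vᴴ * V = 1) {p : Fin k → ℝ}
    (hp : ∀ i, 0 ≤ p i) :
    logDet (1 + rx (U * diagonal (fun i => (σ i : ℂ)) * Vᴴ)
        (V * diagonal (fun i => (p i : ℂ)) * Vᴴ)) = ∑ i, Real.log (1 + σ i ^ 2 * p i) := by
  have hpos (i : Fin k) : 0 < 1 + σ i ^ 2 * p i := by have := hp i; positivity
  have hdiag : 1 + diagonal (fun i => (σ i : ℂ)) * diagonal (fun i => (p i : ℂ)) *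
      diagonal (fun i => (σ i : ℂ)) = diagonal fun i => ((1 + σ i ^ 2 * p i : ℝ) : ℂ) := by
    rw [diagonal_mul_diagonal, diagonal_mul_diagonal, ← diagonal_one, diagonal_add]
    refine congrArg diagonal (funext fun i => ?_)
    push_cast
    ring
  rw [logDet_one_add_rx_svd hU, conjTranspose_mul_conj_diagonal_mul hV, hdiag, logDet,
    det_diagonal, ← Complex.ofReal_prod, Complex.ofReal_re,
    Real.log_prod fun i _ => (hpos i).ne']

end ThinSVD

namespace IsWaterFilling

variable {H : Matrix (Fin m) (Fin n) ℂ} {P r : ℝ} {S : Matrix (Fin n) (Fin n) ℂ}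

lemma mem_feasible (h : IsWaterFilling H P S r) : S ∈ feasible n P := by
  obtain ⟨-, V, σ, μ, -, hV, -, -, hsum, rfl, -⟩ := h
  refine ⟨PosSemidef.mul_mul_conjTranspose_same (PosSemidef.diagonal fun i => ?_) V, ?_⟩
  · simpa using waterPower_nonneg μ (σ i)
  · rw [Matrix.mul_assoc, trace_mul_comm, Matrix.mul_assoc, hV, Matrix.mul_one, trace_diagonal,
      ← Complex.ofReal_sum, Complex.ofReal_re, hsum]

lemma rate_eq (h : IsWaterFilling H P S r) : r = logDet (1 + rx H S) := by
  obtain ⟨U, V, σ, μ, hU, hV, -, rfl, -, rfl, rfl⟩ := h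
  exact (logDet_one_add_rx_svd_diagonal hU hV fun i => waterPower_nonneg μ (σ i)).symm

lemma isMaxOn (h : IsWaterFilling H P S r) (hP : 0 < P) :
    IsMaxOn (fun T => logDet (1 + rx H T)) (feasible n P) S := by
  refine isMaxOn_iff.mpr fun T ⟨hT, hTP⟩ => h.rate_eq ▸ ?_
  obtain ⟨U, V, σ, μ, hU, hV, -, rfl, hsum, -, rfl⟩ := h
  have hμ : 0 < μ := by
    by_contra! hμ
    simp [waterPower_eq_zero_of_nonpos hμ, hP.ne] at hsum
  set x : Fin (min n m) → ℝ := fun i => ((Vᴴ * T * V) i i).re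
  have hx (i) : 0 ≤ x i := (Complex.nonneg_iff.mp (hT.conjTranspose_mul_mul_same V).diag_nonneg).1
  have hxP : ∑ i, x i ≤ P := by
    have := (Complex.le_def.mp (trace_conjTranspose_mul_mul_le hV hT)).1
    simp only [x, ← Complex.re_sum]
    exact this.trans hTP
  calc logDet (1 + rx (U * diagonal (fun i => (σ i : ℂ)) * Vᴴ) T)
      ≤ ∑ i, Real.log (1 + σ i ^ 2 * x i) := logDet_one_add_rx_svd_le hU hT
    _ ≤ ∑ i, (Real.log (1 + σ i ^ 2 * waterPower μ (σ i)) + (x i - waterPower μ (σ i)) / μ) :=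
        Finset.sum_le_sum fun i _ => log_one_add_mul_le_waterPower hμ (σ i) (hx i)
    _ = ∑ i, Real.log (1 + σ i ^ 2 * waterPower μ (σ i)) + (∑ i, x i - P) / μ := by
        rw [Finset.sum_add_distrib, ← Finset.sum_div, Finset.sum_sub_distrib, hsum]
    _ ≤ ∑ i, Real.log (1 + σ i ^ 2 * waterPower μ (σ i)) :=
        add_le_of_nonpos_right (div_nonpos_of_nonpos_of_nonneg (sub_nonpos.mpr hxP) hμ.le)

end IsWaterFilling

end WaterFilling

section Rates

section LogDetInv

variable {m : ℕ} {M X Y : Matrix (Fin m) (Fin m) ℂ}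

lemma logDet_one_add_inv_mul (hM : M.PosDef) (hY : Y.PosSemidef) :
    logDet (1 + M⁻¹ * Y) = logDet (M + Y) - logDet M := by
  have h : 1 + M⁻¹ * Y = M⁻¹ * (M + Y) := by
    rw [Matrix.mul_add, nonsing_inv_mul M ((isUnit_iff_isUnit_det M).mp hM.isUnit)]
  rw [h, logDet_inv_mul hM (hM.add_posSemidef hY).det_pos]

open scoped MatrixOrder Matrix.Norms.L2Operator in
lemma logDet_one_add_inv_mul_le (hX : X.PosSemidef) (hY : Y.PosSemidef) :
    logDet (1 + (1 + X)⁻¹ * Y) ≤ logDet (1 + Y) := by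
  have hX1 : (1 + X).PosDef := PosDef.one.add_posSemidef hX
  have hinv : (1 + X)⁻¹ ≤ 1 := by
    simpa using CStarAlgebra.inv_le_one (a := hX1.isUnit.unit) (le_add_of_nonneg_right hX.nonneg)
  obtain ⟨C, rfl⟩ := exists_eq_conjTranspose_mul_self hY
  have hle : 1 + C * (1 + X)⁻¹ * Cᴴ ≤ 1 + C * 1 * Cᴴ :=
    add_le_add_right (star_right_conjugate_le_conjugate hinv C) 1
  calc logDet (1 + (1 + X)⁻¹ * (Cᴴ * C))
      = logDet (1 + C * (1 + X)⁻¹ * Cᴴ) := by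
        rw [logDet, ← Matrix.mul_assoc, det_one_add_mul_comm, ← Matrix.mul_assoc, logDet]
    _ ≤ logDet (1 + C * 1 * Cᴴ) :=
        strictMonoOn_logDet.monotoneOn
          (PosDef.one.add_posSemidef (hX1.inv.posSemidef.mul_mul_conjTranspose_same C))
          (PosDef.one.add_posSemidef (PosSemidef.one.mul_mul_conjTranspose_same C)) hle
    _ = logDet (1 + Cᴴ * C) := by
        rw [Matrix.mul_one, logDet, det_one_add_mul_comm, logDet]

end LogDetInv

variable {m n₁ n₂ : ℕ} {H₁₁ : Matrix (Fin m) (Fin n₁) ℂ} {H₂₁ : Matrix (Fin m) (Fin n₂) ℂ}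
  {S₂ : Matrix (Fin n₂) (Fin n₂) ℂ} {S : Matrix (Fin n₁) (Fin n₁) ℂ} {P r₂ μ : ℝ}

lemma posDef_one_add_rx (H₂₁ : Matrix (Fin m) (Fin n₂) ℂ) (hS₂ : S₂.PosSemidef) :
    (1 + rx H₂₁ S₂).PosDef :=
  PosDef.one.add_posSemidef (rx_posSemidef H₂₁ hS₂)

variable (H₁₁ H₂₁)

lemma sumRate_eq_logDet (S₂ : Matrix (Fin n₂) (Fin n₂) ℂ) (S : Matrix (Fin n₁) (Fin n₁) ℂ) :
    sumRate H₁₁ H₂₁ S₂ S = logDet (1 + rx H₂₁ S₂ + rx H₁₁ S) := by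
  rw [sumRate, add_right_comm]

lemma Ra_eq (hS₂ : S₂.PosSemidef) (hS : S.PosSemidef) :
    Ra H₁₁ H₂₁ S₂ S = sumRate H₁₁ H₂₁ S₂ S - ownRate H₁₁ S :=
  logDet_one_add_inv_mul (posDef_one_add_rx H₁₁ hS) (rx_posSemidef H₂₁ hS₂)

lemma noiseRate_eq (hS₂ : S₂.PosSemidef) (hS : S.PosSemidef) :
    noiseRate H₁₁ H₂₁ S₂ S = sumRate H₁₁ H₂₁ S₂ S - Rb H₂₁ S₂ := by
  rw [sumRate_eq_logDet]
  exact logDet_one_add_inv_mul (posDef_one_add_rx H₂₁ hS₂) (rx_posSemidef H₁₁ hS)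

lemma Ra_le_Rb (hS₂ : S₂.PosSemidef) (hS : S.PosSemidef) : Ra H₁₁ H₂₁ S₂ S ≤ Rb H₂₁ S₂ :=
  logDet_one_add_inv_mul_le (rx_posSemidef H₁₁ hS) (rx_posSemidef H₂₁ hS₂)

open scoped MatrixOrder Matrix.Norms.L2Operator in
lemma logDet_one_add_rx_whitened (hS₂ : S₂.PosSemidef) (S : Matrix (Fin n₁) (Fin n₁) ℂ) :
    logDet (1 + rx (whitened H₁₁ H₂₁ S₂) S) = noiseRate H₁₁ H₂₁ S₂ S := by
  set R := CFC.sqrt ((1 + rx H₂₁ S₂)⁻¹)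
  have hR : Rᴴ = R := (CFC.sqrt_nonneg _).posSemidef.isHermitian
  have hRR : R * R = (1 + rx H₂₁ S₂)⁻¹ :=
    CFC.sqrt_mul_sqrt_self _ (posDef_one_add_rx H₂₁ hS₂).inv.posSemidef.nonneg
  have hrx : rx (R * H₁₁) S = R * (rx H₁₁ S * R) := by
    simp only [rx, conjTranspose_mul, hR, Matrix.mul_assoc]
  rw [whitened, hrx, logDet, det_one_add_mul_comm, Matrix.mul_assoc, hRR, det_one_add_mul_comm,
    noiseRate, logDet]

variable {H₁₁} in
open scoped MatrixOrder Matrix.Norms.L2Operator in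
lemma whitened_ne_zero (hS₂ : S₂.PosSemidef) (hH : H₁₁ ≠ 0) : whitened H₁₁ H₂₁ S₂ ≠ 0 := by
  have hM : ((1 + rx H₂₁ S₂)⁻¹).PosDef := (posDef_one_add_rx H₂₁ hS₂).inv
  have hR : IsUnit (CFC.sqrt ((1 + rx H₂₁ S₂)⁻¹)).det :=
    (isUnit_iff_isUnit_det _).mp ((CFC.isUnit_sqrt_iff _ hM.posSemidef.nonneg).mpr hM.isUnit)
  intro h
  rw [whitened] at h
  exact hH (by rw [← nonsing_inv_mul_cancel_left _ H₁₁ hR, h, Matrix.mul_zero])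

lemma continuousOn_ownRate (P : ℝ) : ContinuousOn (ownRate H₁₁) (feasible n₁ P) :=
  continuousOn_logDet_add_rx PosDef.one H₁₁ P

lemma continuousOn_sumRate (hS₂ : S₂.PosSemidef) (P : ℝ) :
    ContinuousOn (sumRate H₁₁ H₂₁ S₂) (feasible n₁ P) :=
  (continuousOn_logDet_add_rx (posDef_one_add_rx H₂₁ hS₂) H₁₁ P).congr
    fun S _ => sumRate_eq_logDet H₁₁ H₂₁ S₂ S

lemma concaveOn_ownRate (P : ℝ) : ConcaveOn ℝ (feasible n₁ P) (ownRate H₁₁) :=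
  concaveOn_logDet_add_rx PosDef.one H₁₁ P

lemma concaveOn_sumRate (hS₂ : S₂.PosSemidef) (P : ℝ) :
    ConcaveOn ℝ (feasible n₁ P) (sumRate H₁₁ H₂₁ S₂) :=
  (concaveOn_logDet_add_rx (posDef_one_add_rx H₂₁ hS₂) H₁₁ P).congr
    fun S _ => (sumRate_eq_logDet H₁₁ H₂₁ S₂ S).symm

variable (S₂) in
/-- The objective of problem (P3) with weight `μ`. -/
noncomputable def weightedRate (μ : ℝ) (S : Matrix (Fin n₁) (Fin n₁) ℂ) : ℝ :=
  μ * ownRate H₁₁ S + (1 - μ) * sumRate H₁₁ H₂₁ S₂ S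

lemma weightedRate_one : weightedRate H₁₁ H₂₁ S₂ 1 = ownRate H₁₁ := by
  funext S
  simp [weightedRate]

lemma weightedRate_zero : weightedRate H₁₁ H₂₁ S₂ 0 = sumRate H₁₁ H₂₁ S₂ := by
  funext S
  simp [weightedRate]

lemma exists_isP3Solution (hS₂ : S₂.PosSemidef) (hP : 0 ≤ P) (μ : ℝ) :
    ∃ S, IsP3Solution H₁₁ H₂₁ S₂ P μ S :=
  (isCompact_feasible n₁ hP).exists_isMaxOn (nonempty_feasible n₁ hP)
    (((continuousOn_ownRate H₁₁ P).const_mul μ).add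
      ((continuousOn_sumRate H₁₁ H₂₁ hS₂ P).const_mul (1 - μ)))

variable {H₁₁ H₂₁}

open scoped MatrixOrder in
lemma IsP3Solution.isUniqueMaxOn (h : IsP3Solution H₁₁ H₂₁ S₂ P μ S) (hS₂ : S₂.PosSemidef)
    (hH : H₁₁ ≠ 0) (h0 : 0 ≤ μ) (h1 : μ ≤ 1) :
    IsUniqueMaxOn (weightedRate H₁₁ H₂₁ S₂ μ) (feasible n₁ P) S := by
  have hM := posDef_one_add_rx H₂₁ hS₂
  set φ : Matrix (Fin m) (Fin m) ℂ → ℝ :=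
    fun R => μ * logDet (1 + R) + (1 - μ) * logDet (1 + rx H₂₁ S₂ + R)
  have hφ : weightedRate H₁₁ H₂₁ S₂ μ = fun X => φ (rx H₁₁ X) := by
    funext X
    rw [weightedRate, sumRate_eq_logDet, ownRate]
  refine .of_isMaxOn_of_forall_eq h.1 h.2 fun T hT hmax => ?_
  refine eq_of_isMaxOn hH
    (strictMonoOn_convex_combination h0 h1 (strictMonoOn_logDet_add PosDef.one)
      (strictMonoOn_logDet_add hM))
    (strictConcaveOn_convex_combination h0 h1 (strictConcaveOn_logDet_add PosDef.one)
      (strictConcaveOn_logDet_add hM)) hT h.1 (hφ ▸ hmax) ?_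
  exact hφ ▸ (show IsMaxOn (weightedRate H₁₁ H₂₁ S₂ μ) _ _ from h.2)

lemma IsWaterFilling.isP3Solution_one {r : ℝ} (h : IsWaterFilling H₁₁ P S r) (hP : 0 < P)
    (H₂₁ : Matrix (Fin m) (Fin n₂) ℂ) (S₂ : Matrix (Fin n₂) (Fin n₂) ℂ) :
    IsP3Solution H₁₁ H₂₁ S₂ P 1 S := by
  refine ⟨h.mem_feasible, ?_⟩
  change IsMaxOn (weightedRate H₁₁ H₂₁ S₂ 1) _ S
  rw [weightedRate_one]
  exact h.isMaxOn hP

lemma IsWaterFilling.rate_eq_of_whitened {r : ℝ} (h : IsWaterFilling (whitened H₁₁ H₂₁ S₂) P S r)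
    (hS₂ : S₂.PosSemidef) : r = sumRate H₁₁ H₂₁ S₂ S - Rb H₂₁ S₂ := by
  rw [h.rate_eq, logDet_one_add_rx_whitened H₁₁ H₂₁ hS₂, noiseRate_eq H₁₁ H₂₁ hS₂ h.mem_feasible.1]

lemma IsWaterFilling.isP3Solution_zero {r : ℝ} (h : IsWaterFilling (whitened H₁₁ H₂₁ S₂) P S r)
    (hS₂ : S₂.PosSemidef) (hP : 0 < P) : IsP3Solution H₁₁ H₂₁ S₂ P 0 S := by
  refine ⟨h.mem_feasible, ?_⟩
  change IsMaxOn (weightedRate H₁₁ H₂₁ S₂ 0) _ S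
  rw [weightedRate_zero]
  refine isMaxOn_iff.mpr fun T hT => ?_
  have hmax := isMaxOn_iff.mp (h.isMaxOn hP) T hT
  simp only [logDet_one_add_rx_whitened H₁₁ H₂₁ hS₂, noiseRate_eq H₁₁ H₂₁ hS₂ hT.1,
    noiseRate_eq H₁₁ H₂₁ hS₂ h.mem_feasible.1] at hmax
  linarith

lemma omdRate_eq_min (hS₂ : S₂.PosSemidef) (hr : r₂ ≤ Rb H₂₁ S₂) (hS : S.PosSemidef) :
    omdRate H₁₁ H₂₁ S₂ r₂ S = min (ownRate H₁₁ S) (sumRate H₁₁ H₂₁ S₂ S - r₂) := by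
  have hRa := Ra_eq H₁₁ H₂₁ hS₂ hS
  by_cases h : r₂ ≤ Ra H₁₁ H₂₁ S₂ S
  · rw [omdRate, omdDecoding, if_pos h, decodingRate, min_eq_left (by linarith)]
  · rw [omdRate, omdDecoding, if_neg h, if_pos hr, decodingRate, min_eq_right (by linarith)]

lemma omdDecoding_eq_SUD (hS₂ : S₂.PosSemidef) (hr : Rb H₂₁ S₂ < r₂) (hS : S.PosSemidef) :
    omdDecoding H₁₁ H₂₁ S₂ r₂ S = .SUD := by
  have hRa := Ra_le_Rb H₁₁ H₂₁ hS₂ hS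
  rw [omdDecoding, if_neg (by linarith), if_neg (by linarith)]

lemma omdRate_eq_sumRate_sub_Rb (hS₂ : S₂.PosSemidef) (hr : Rb H₂₁ S₂ < r₂) (hS : S.PosSemidef) :
    omdRate H₁₁ H₂₁ S₂ r₂ S = sumRate H₁₁ H₂₁ S₂ S - Rb H₂₁ S₂ := by
  rw [omdRate, omdDecoding_eq_SUD hS₂ hr hS, decodingRate, noiseRate_eq H₁₁ H₂₁ hS₂ hS]

lemma omdRate_le_weightedRate_sub (hS₂ : S₂.PosSemidef) (hr : r₂ ≤ Rb H₂₁ S₂) (h0 : 0 ≤ μ)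
    (h1 : μ ≤ 1) (hS : S.PosSemidef) :
    omdRate H₁₁ H₂₁ S₂ r₂ S ≤ weightedRate H₁₁ H₂₁ S₂ μ S - (1 - μ) * r₂ := by
  have hmin := omdRate_eq_min (H₁₁ := H₁₁) hS₂ hr hS
  have hown := mul_le_mul_of_nonneg_left (hmin.trans_le (min_le_left _ _)) h0
  have hsum := mul_le_mul_of_nonneg_left (hmin.trans_le (min_le_right _ _)) (sub_nonneg.mpr h1)
  rw [weightedRate]
  linarith

lemma IsP3Solution.isUniqueMaxOn_omdRate (h : IsP3Solution H₁₁ H₂₁ S₂ P μ S)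
    (hS₂ : S₂.PosSemidef) (hH : H₁₁ ≠ 0) (hr : r₂ ≤ Rb H₂₁ S₂) (h0 : 0 ≤ μ) (h1 : μ ≤ 1)
    (heq : omdRate H₁₁ H₂₁ S₂ r₂ S = weightedRate H₁₁ H₂₁ S₂ μ S - (1 - μ) * r₂) :
    IsUniqueMaxOn (omdRate H₁₁ H₂₁ S₂ r₂) (feasible n₁ P) S :=
  ((h.isUniqueMaxOn hS₂ hH h0 h1).sub_const ((1 - μ) * r₂)).of_le_of_eq
    (fun _ hT => omdRate_le_weightedRate_sub hS₂ hr h0 h1 hT.1) heq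

lemma IsUniqueMaxOn.isOMDSolution {d : Decoding}
    (h : IsUniqueMaxOn (omdRate H₁₁ H₂₁ S₂ r₂) (feasible n₁ P) S)
    (hd : omdDecoding H₁₁ H₂₁ S₂ r₂ S = d) :
    IsOMDSolution H₁₁ H₂₁ S₂ P r₂ S (decodingRate H₁₁ H₂₁ S₂ r₂ S d) d where
  optimal_iff _ := h.mem_and_isMaxOn_iff
  value_eq := by rw [omdRate, hd]
  decoding_eq := hd

lemma IsWaterFilling.isOMDSolution_SD {r : ℝ} (h : IsWaterFilling H₁₁ P S r)
    (hS₂ : S₂.PosSemidef) (hP : 0 < P) (hH : H₁₁ ≠ 0) (hr : r₂ ≤ Ra H₁₁ H₂₁ S₂ S) :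
    IsOMDSolution H₁₁ H₂₁ S₂ P r₂ S r .SD := by
  have hSD : omdDecoding H₁₁ H₂₁ S₂ r₂ S = .SD := if_pos hr
  have hrb : r₂ ≤ Rb H₂₁ S₂ := hr.trans (Ra_le_Rb H₁₁ H₂₁ hS₂ h.mem_feasible.1)
  have heq : omdRate H₁₁ H₂₁ S₂ r₂ S = weightedRate H₁₁ H₂₁ S₂ 1 S - (1 - 1) * r₂ := by
    rw [omdRate, hSD, decodingRate, weightedRate_one]
    ring
  rw [h.rate_eq]
  exact ((h.isP3Solution_one hP H₂₁ S₂).isUniqueMaxOn_omdRate hS₂ hH hrb zero_le_one le_rfl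
    heq).isOMDSolution hSD

lemma IsWaterFilling.isOMDSolution_JD {r : ℝ} (h : IsWaterFilling (whitened H₁₁ H₂₁ S₂) P S r)
    (hS₂ : S₂.PosSemidef) (hP : 0 < P) (hH : H₁₁ ≠ 0) (hra : Ra H₁₁ H₂₁ S₂ S < r₂)
    (hrb : r₂ ≤ Rb H₂₁ S₂) : IsOMDSolution H₁₁ H₂₁ S₂ P r₂ S (r + Rb H₂₁ S₂ - r₂) .JD := by
  have hJD : omdDecoding H₁₁ H₂₁ S₂ r₂ S = .JD := by
    rw [omdDecoding, if_neg hra.not_ge, if_pos hrb]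
  have heq : omdRate H₁₁ H₂₁ S₂ r₂ S = weightedRate H₁₁ H₂₁ S₂ 0 S - (1 - 0) * r₂ := by
    rw [omdRate, hJD, decodingRate, weightedRate_zero]
    ring
  rw [h.rate_eq_of_whitened hS₂, sub_add_cancel]
  exact ((h.isP3Solution_zero hS₂ hP).isUniqueMaxOn_omdRate hS₂ hH hrb le_rfl zero_le_one
    heq).isOMDSolution hJD

lemma IsWaterFilling.isOMDSolution_SUD {r : ℝ} (h : IsWaterFilling (whitened H₁₁ H₂₁ S₂) P S r)
    (hS₂ : S₂.PosSemidef) (hP : 0 < P) (hH : H₁₁ ≠ 0) (hr : Rb H₂₁ S₂ < r₂) :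
    IsOMDSolution H₁₁ H₂₁ S₂ P r₂ S r .SUD := by
  have hmem := h.mem_feasible
  have hmax := (h.isP3Solution_zero hS₂ hP).isUniqueMaxOn hS₂ hH le_rfl zero_le_one
  rw [weightedRate_zero] at hmax
  rw [h.rate_eq_of_whitened hS₂, ← noiseRate_eq H₁₁ H₂₁ hS₂ hmem.1]
  exact ((hmax.sub_const (Rb H₂₁ S₂)).of_le_of_eq
    (fun T hT => (omdRate_eq_sumRate_sub_Rb hS₂ hr hT.1).le)
    (omdRate_eq_sumRate_sub_Rb hS₂ hr hmem.1)).isOMDSolution (omdDecoding_eq_SUD hS₂ hr hmem.1)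

lemma Ra_le_Ra_of_isP3Solution {SSD SSUD : Matrix (Fin n₁) (Fin n₁) ℂ} (hS₂ : S₂.PosSemidef)
    (hSD : IsP3Solution H₁₁ H₂₁ S₂ P 1 SSD) (hSUD : IsP3Solution H₁₁ H₂₁ S₂ P 0 SSUD) :
    Ra H₁₁ H₂₁ S₂ SSD ≤ Ra H₁₁ H₂₁ S₂ SSUD := by
  have hown := isMaxOn_iff.mp hSD.2 SSUD hSUD.1
  have hsum := isMaxOn_iff.mp hSUD.2 SSD hSD.1
  rw [Ra_eq H₁₁ H₂₁ hS₂ hSD.1.1, Ra_eq H₁₁ H₂₁ hS₂ hSUD.1.1]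
  linarith

end Rates

section Duality

variable {m n₁ n₂ : ℕ} {H₁₁ : Matrix (Fin m) (Fin n₁) ℂ} {H₂₁ : Matrix (Fin m) (Fin n₂) ℂ}
  {S₂ : Matrix (Fin n₂) (Fin n₂) ℂ} {S T : Matrix (Fin n₁) (Fin n₁) ℂ} {P r₂ μ μ₁ μ₂ : ℝ}

open scoped MatrixOrder in
lemma exists_mem_feasible_rx_pos (hH : H₁₁ ≠ 0) (hP : 0 < P) :
    ∃ S ∈ feasible n₁ P, 0 < rx H₁₁ S := by
  set ε : ℝ := P / (n₁ + 1)
  have hε : 0 < ε := by positivity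
  have hεn : ε * n₁ ≤ P := by
    rw [div_mul_eq_mul_div, div_le_iff₀ (by positivity)]
    nlinarith
  refine ⟨ε • 1, ⟨PosSemidef.one.smul hε.le, by simpa using hεn⟩, ?_⟩
  simpa [rx] using rx_lt_rx_add_smul_one hH 0 hε

lemma continuousOn_omdRate (hS₂ : S₂.PosSemidef) (hr : r₂ ≤ Rb H₂₁ S₂) :
    ContinuousOn (omdRate H₁₁ H₂₁ S₂ r₂) (feasible n₁ P) :=
  ((continuousOn_ownRate H₁₁ P).inf
    ((continuousOn_sumRate H₁₁ H₂₁ hS₂ P).sub continuousOn_const)).congr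
    fun _ hS => omdRate_eq_min hS₂ hr hS.1

open scoped MatrixOrder in
lemma exists_omdRate_pos (hS₂ : S₂.PosSemidef) (hH : H₁₁ ≠ 0) (hP : 0 < P)
    (hr : r₂ ≤ Rb H₂₁ S₂) : ∃ S ∈ feasible n₁ P, 0 < omdRate H₁₁ H₂₁ S₂ r₂ S := by
  obtain ⟨S, hS, hpos⟩ := exists_mem_feasible_rx_pos hH hP
  have hlt : ∀ {M : Matrix (Fin m) (Fin m) ℂ}, M.PosDef →
      logDet M < logDet (M + rx H₁₁ S) := fun {M} hM => by
    simpa using strictMonoOn_logDet_add hM PosSemidef.zero (rx_posSemidef H₁₁ hS.1) hpos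
  refine ⟨S, hS, ?_⟩
  rw [omdRate_eq_min hS₂ hr hS.1, sumRate_eq_logDet]
  exact lt_min (by simpa [ownRate, logDet] using hlt PosDef.one)
    (sub_pos.mpr (hr.trans_lt (hlt (posDef_one_add_rx H₂₁ hS₂))))

lemma exists_isMaxOn_omdRate_pos (hS₂ : S₂.PosSemidef) (hH : H₁₁ ≠ 0) (hP : 0 < P)
    (hr : r₂ ≤ Rb H₂₁ S₂) :
    ∃ S ∈ feasible n₁ P, IsMaxOn (omdRate H₁₁ H₂₁ S₂ r₂) (feasible n₁ P) S ∧
      0 < omdRate H₁₁ H₂₁ S₂ r₂ S := by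
  obtain ⟨S, hS, hmax⟩ := (isCompact_feasible n₁ hP.le).exists_isMaxOn
    (nonempty_feasible n₁ hP.le) (continuousOn_omdRate (H₁₁ := H₁₁) hS₂ hr)
  obtain ⟨T, hT, hpos⟩ := exists_omdRate_pos hS₂ hH hP hr
  exact ⟨S, hS, hmax, hpos.trans_le (isMaxOn_iff.mp hmax T hT)⟩

lemma exists_weightedRate_sub_le_omdRate (hS₂ : S₂.PosSemidef) (hP : 0 ≤ P)
    (hr : r₂ ≤ Rb H₂₁ S₂) (hmax : IsMaxOn (omdRate H₁₁ H₂₁ S₂ r₂) (feasible n₁ P) S) :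
    ∃ μ, 0 ≤ μ ∧ μ ≤ 1 ∧ ∀ T ∈ feasible n₁ P,
      weightedRate H₁₁ H₂₁ S₂ μ T - (1 - μ) * r₂ ≤ omdRate H₁₁ H₂₁ S₂ r₂ S := by
  obtain ⟨w, hw, hle⟩ := exists_mem_stdSimplex_forall_sum_mul_le
    (f := ![ownRate H₁₁, fun T => sumRate H₁₁ H₂₁ S₂ T - r₂])
    (s := feasible n₁ P) (v := omdRate H₁₁ H₂₁ S₂ r₂ S)
    (Fin.forall_fin_two.mpr ⟨concaveOn_ownRate H₁₁ P,
      (concaveOn_sumRate H₁₁ H₂₁ hS₂ P).sub (convexOn_const r₂ (convex_feasible n₁ P))⟩)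
    (nonempty_feasible n₁ hP) fun T hT => by
      have hTS := isMaxOn_iff.mp hmax T hT
      rw [omdRate_eq_min hS₂ hr hT.1, min_le_iff] at hTS
      exact Fin.exists_fin_two.mpr hTS
  have hsum : w 0 + w 1 = 1 := by simpa [Fin.sum_univ_two] using hw.2
  have hw1 : w 1 = 1 - w 0 := eq_sub_of_add_eq' hsum
  refine ⟨w 0, hw.1 0, by linarith [hw.1 1], fun T hT => ?_⟩
  have hT := hle T hT
  simp only [Fin.sum_univ_two, hw1, cons_val_zero, cons_val_one] at hT
  rw [weightedRate]
  linarith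

lemma lagrangian_one_sub (r : ℝ) :
    lagrangian H₁₁ H₂₁ S₂ r₂ r T μ (1 - μ) = weightedRate H₁₁ H₂₁ S₂ μ T - (1 - μ) * r₂ := by
  rw [lagrangian, weightedRate]
  ring

lemma dualFun_le_coe_iff {v : ℝ} :
    dualFun H₁₁ H₂₁ S₂ P r₂ μ₁ μ₂ ≤ (v : EReal) ↔
      ∀ r, 0 ≤ r → ∀ T ∈ feasible n₁ P, lagrangian H₁₁ H₂₁ S₂ r₂ r T μ₁ μ₂ ≤ v := by
  simp only [dualFun, iSup_le_iff, Subtype.forall, Prod.forall, EReal.coe_le_coe_iff, and_imp]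
  exact forall_congr' fun _ => forall_comm

lemma coe_omdRate_le_dualFun (hS₂ : S₂.PosSemidef) (hr : r₂ ≤ Rb H₂₁ S₂)
    (hS : S ∈ feasible n₁ P) (hpos : 0 ≤ omdRate H₁₁ H₂₁ S₂ r₂ S) (h1 : 0 ≤ μ₁) (h2 : 0 ≤ μ₂) :
    (omdRate H₁₁ H₂₁ S₂ r₂ S : EReal) ≤ dualFun H₁₁ H₂₁ S₂ P r₂ μ₁ μ₂ := by
  refine le_trans (EReal.coe_le_coe_iff.mpr ?_)
    (le_iSup (fun x : {x : ℝ × Matrix (Fin n₁) (Fin n₁) ℂ // 0 ≤ x.1 ∧ x.2 ∈ feasible n₁ P} =>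
      ((lagrangian H₁₁ H₂₁ S₂ r₂ x.1.1 x.1.2 μ₁ μ₂ : ℝ) : EReal))
      ⟨(omdRate H₁₁ H₂₁ S₂ r₂ S, S), hpos, hS⟩)
  have hmin := omdRate_eq_min (H₁₁ := H₁₁) hS₂ hr hS.1
  have hown := hmin.trans_le (min_le_left _ _)
  have hsum := hmin.trans_le (min_le_right _ _)
  simp only [lagrangian]
  nlinarith

lemma add_eq_one_of_dualFun_le (hS : S ∈ feasible n₁ P) (hS₂ : S₂.PosSemidef)
    (hr : r₂ ≤ Rb H₂₁ S₂) (hpos : 0 < omdRate H₁₁ H₂₁ S₂ r₂ S) (h1 : 0 ≤ μ₁) (h2 : 0 ≤ μ₂)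
    (hle : dualFun H₁₁ H₂₁ S₂ P r₂ μ₁ μ₂ ≤ (omdRate H₁₁ H₂₁ S₂ r₂ S : EReal)) :
    μ₁ + μ₂ = 1 := by
  set v := omdRate H₁₁ H₂₁ S₂ r₂ S
  have hmin : v = _ := omdRate_eq_min hS₂ hr hS.1
  have hown := mul_le_mul_of_nonneg_left (hmin.trans_le (min_le_left _ _)) h1
  have hsum := mul_le_mul_of_nonneg_left (hmin.trans_le (min_le_right _ _)) h2
  have hslope : ∀ r, 0 ≤ r → (1 - (μ₁ + μ₂)) * (r - v) ≤ 0 := fun r hr0 => by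
    have hL := dualFun_le_coe_iff.mp hle r hr0 S hS
    rw [lagrangian] at hL
    linarith
  have hup := hslope (v + 1) (by linarith)
  have hdown := hslope 0 le_rfl
  nlinarith

lemma isDualOptimal_iff (hS₂ : S₂.PosSemidef) (hr : r₂ ≤ Rb H₂₁ S₂) (hS : S ∈ feasible n₁ P)
    (hmax : IsMaxOn (omdRate H₁₁ H₂₁ S₂ r₂) (feasible n₁ P) S)
    (hpos : 0 < omdRate H₁₁ H₂₁ S₂ r₂ S) :
    IsDualOptimal H₁₁ H₂₁ S₂ P r₂ μ₁ μ₂ ↔ 0 ≤ μ₁ ∧ μ₁ ≤ 1 ∧ μ₂ = 1 - μ₁ ∧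
      ∀ T ∈ feasible n₁ P,
        weightedRate H₁₁ H₂₁ S₂ μ₁ T - (1 - μ₁) * r₂ ≤ omdRate H₁₁ H₂₁ S₂ r₂ S := by
  have hdual : ∀ {μ : ℝ}, dualFun H₁₁ H₂₁ S₂ P r₂ μ (1 - μ) ≤ omdRate H₁₁ H₂₁ S₂ r₂ S ↔
      ∀ T ∈ feasible n₁ P,
        weightedRate H₁₁ H₂₁ S₂ μ T - (1 - μ) * r₂ ≤ omdRate H₁₁ H₂₁ S₂ r₂ S := fun {μ} => by
    simp only [dualFun_le_coe_iff, lagrangian_one_sub]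
    exact ⟨fun h => h 0 le_rfl, fun h _ _ => h⟩
  constructor
  · rintro ⟨h1, h2, hmin⟩
    have hPS : 0 ≤ P := (Complex.nonneg_iff.mp hS.1.trace_nonneg).1.trans hS.2
    obtain ⟨μ, h0μ, hμ1, hμ⟩ := exists_weightedRate_sub_le_omdRate hS₂ hPS hr hmax
    have hle := (hmin μ (1 - μ) h0μ (sub_nonneg.mpr hμ1)).trans (hdual.mpr hμ)
    obtain rfl : μ₂ = 1 - μ₁ :=
      eq_sub_of_add_eq' (add_eq_one_of_dualFun_le hS hS₂ hr hpos h1 h2 hle)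
    exact ⟨h1, sub_nonneg.mp h2, rfl, hdual.mp hle⟩
  · rintro ⟨h0, h1, rfl, hle⟩
    exact ⟨h0, sub_nonneg.mpr h1, fun ν₁ ν₂ hν₁ hν₂ =>
      (hdual.mpr hle).trans (coe_omdRate_le_dualFun hS₂ hr hS hpos.le hν₁ hν₂)⟩

lemma exists_isDualOptimal (hS₂ : S₂.PosSemidef) (hH : H₁₁ ≠ 0) (hP : 0 < P)
    (hr : r₂ ≤ Rb H₂₁ S₂) : ∃ μ₁ μ₂, IsDualOptimal H₁₁ H₂₁ S₂ P r₂ μ₁ μ₂ := by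
  obtain ⟨S, hS, hmax, hpos⟩ := exists_isMaxOn_omdRate_pos hS₂ hH hP hr
  obtain ⟨μ, h0, h1, hμ⟩ := exists_weightedRate_sub_le_omdRate hS₂ hP.le hr hmax
  exact ⟨μ, 1 - μ, (isDualOptimal_iff hS₂ hr hS hmax hpos).mpr ⟨h0, h1, rfl, hμ⟩⟩

lemma IsDualOptimal.le_one (h : IsDualOptimal H₁₁ H₂₁ S₂ P r₂ μ₁ μ₂) (hS₂ : S₂.PosSemidef)
    (hH : H₁₁ ≠ 0) (hP : 0 < P) (hr : r₂ ≤ Rb H₂₁ S₂) : μ₁ ≤ 1 := by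
  obtain ⟨S, hS, hmax, hpos⟩ := exists_isMaxOn_omdRate_pos hS₂ hH hP hr
  exact ((isDualOptimal_iff hS₂ hr hS hmax hpos).mp h).2.1

/-- By strong duality an optimum of (P1) attains the bound `omdRate_le_weightedRate_sub` at a dual
optimum, so it is a solution of (P3), which is unique. -/
lemma IsDualOptimal.omdRate_eq_weightedRate_sub (h : IsDualOptimal H₁₁ H₂₁ S₂ P r₂ μ₁ μ₂)
    (hS₂ : S₂.PosSemidef) (hH : H₁₁ ≠ 0) (hP : 0 < P) (hr : r₂ ≤ Rb H₂₁ S₂)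
    (hS : IsP3Solution H₁₁ H₂₁ S₂ P μ₁ S) :
    omdRate H₁₁ H₂₁ S₂ r₂ S = weightedRate H₁₁ H₂₁ S₂ μ₁ S - (1 - μ₁) * r₂ := by
  obtain ⟨T, hT, hmax, hpos⟩ := exists_isMaxOn_omdRate_pos hS₂ hH hP hr
  obtain ⟨h0, h1, -, hle⟩ := (isDualOptimal_iff hS₂ hr hT hmax hpos).mp h
  have hTle := omdRate_le_weightedRate_sub (H₁₁ := H₁₁) hS₂ hr h0 h1 hT.1
  have hTmax : IsMaxOn (weightedRate H₁₁ H₂₁ S₂ μ₁) (feasible n₁ P) T :=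
    isMaxOn_iff.mpr fun X hX => by linarith [hle X hX]
  obtain rfl : T = S := (hS.isUniqueMaxOn hS₂ hH h0 h1).mem_and_isMaxOn_iff.mp ⟨hT, hTmax⟩
  exact hTle.antisymm (hle T hT)

lemma eq_zero_of_Ra_lt (hS₂ : S₂.PosSemidef) (hr : r₂ ≤ Rb H₂₁ S₂) (hS : S.PosSemidef)
    (heq : omdRate H₁₁ H₂₁ S₂ r₂ S = weightedRate H₁₁ H₂₁ S₂ μ S - (1 - μ) * r₂)
    (hlt : Ra H₁₁ H₂₁ S₂ S < r₂) : μ = 0 := by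
  rw [Ra_eq H₁₁ H₂₁ hS₂ hS] at hlt
  rw [omdRate_eq_min hS₂ hr hS, min_eq_right (by linarith), weightedRate] at heq
  have hmul : μ * (ownRate H₁₁ S - (sumRate H₁₁ H₂₁ S₂ S - r₂)) = 0 := by linarith
  exact (mul_eq_zero.mp hmul).resolve_right (by linarith)

lemma IsDualOptimal.isOMDSolution (h : IsDualOptimal H₁₁ H₂₁ S₂ P r₂ μ₁ μ₂)
    (hS₂ : S₂.PosSemidef) (hH : H₁₁ ≠ 0) (hP : 0 < P) (hT : IsP3Solution H₁₁ H₂₁ S₂ P 0 T)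
    (hr : r₂ ≤ Ra H₁₁ H₂₁ S₂ T) (hS : IsP3Solution H₁₁ H₂₁ S₂ P μ₁ S) :
    IsOMDSolution H₁₁ H₂₁ S₂ P r₂ S (ownRate H₁₁ S) .SD := by
  have hrb : r₂ ≤ Rb H₂₁ S₂ := hr.trans (Ra_le_Rb H₁₁ H₂₁ hS₂ hT.1.1)
  have h1 : μ₁ ≤ 1 := h.le_one hS₂ hH hP hrb
  have heq := h.omdRate_eq_weightedRate_sub hS₂ hH hP hrb hS
  have hSD : r₂ ≤ Ra H₁₁ H₂₁ S₂ S := by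
    by_contra! hlt
    obtain rfl : μ₁ = 0 := eq_zero_of_Ra_lt hS₂ hrb hS.1.1 heq hlt
    obtain rfl : S = T := (hT.isUniqueMaxOn hS₂ hH h.1 h1).mem_and_isMaxOn_iff.mp hS
    exact hlt.not_ge hr
  exact (hS.isUniqueMaxOn_omdRate hS₂ hH hrb h.1 h1 heq).isOMDSolution (if_pos hSD)

end Duality

end OMD

theorem theorem3p1_general {m n₁ n₂ : ℕ}
    (H₁₁ : Matrix (Fin m) (Fin n₁) ℂ) (H₂₁ : Matrix (Fin m) (Fin n₂) ℂ)
    (S₂ : Matrix (Fin n₂) (Fin n₂) ℂ) (hS₂ : S₂.PosSemidef)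
    (P₁ r₂ : ℝ) (hP₁ : 0 < P₁) (hH₁₁ : H₁₁ ≠ 0) :
    (∃ S r, OMD.IsWaterFilling H₁₁ P₁ S r) ∧
    (∃ S r, OMD.IsWaterFilling (OMD.whitened H₁₁ H₂₁ S₂) P₁ S r) ∧
    ∀ (SSD SSUD : Matrix (Fin n₁) (Fin n₁) ℂ) (rSD rSUD : ℝ),
      OMD.IsWaterFilling H₁₁ P₁ SSD rSD →
      OMD.IsWaterFilling (OMD.whitened H₁₁ H₂₁ S₂) P₁ SSUD rSUD →
      OMD.Ra H₁₁ H₂₁ S₂ SSD ≤ OMD.Ra H₁₁ H₂₁ S₂ SSUD ∧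
      OMD.Ra H₁₁ H₂₁ S₂ SSUD ≤ OMD.Rb H₂₁ S₂ ∧
      (r₂ ≤ OMD.Ra H₁₁ H₂₁ S₂ SSD → OMD.IsOMDSolution H₁₁ H₂₁ S₂ P₁ r₂ SSD rSD .SD) ∧
      (r₂ ≤ OMD.Ra H₁₁ H₂₁ S₂ SSUD →
        (∃ μ₁ μ₂, OMD.IsDualOptimal H₁₁ H₂₁ S₂ P₁ r₂ μ₁ μ₂) ∧
        ∀ μ₁ μ₂, OMD.IsDualOptimal H₁₁ H₂₁ S₂ P₁ r₂ μ₁ μ₂ →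
          (∃ S, OMD.IsP3Solution H₁₁ H₂₁ S₂ P₁ μ₁ S) ∧
          ∀ S, OMD.IsP3Solution H₁₁ H₂₁ S₂ P₁ μ₁ S →
            OMD.IsOMDSolution H₁₁ H₂₁ S₂ P₁ r₂ S (OMD.ownRate H₁₁ S) .SD) ∧
      (OMD.Ra H₁₁ H₂₁ S₂ SSUD < r₂ → r₂ ≤ OMD.Rb H₂₁ S₂ →
        OMD.IsOMDSolution H₁₁ H₂₁ S₂ P₁ r₂ SSUD (rSUD + OMD.Rb H₂₁ S₂ - r₂) .JD) ∧
      (OMD.Rb H₂₁ S₂ < r₂ → OMD.IsOMDSolution H₁₁ H₂₁ S₂ P₁ r₂ SSUD rSUD .SUD) := by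
  refine ⟨OMD.exists_isWaterFilling hH₁₁ hP₁.le,
    OMD.exists_isWaterFilling (OMD.whitened_ne_zero H₂₁ hS₂ hH₁₁) hP₁.le,
    fun SSD SSUD rSD rSUD hSD hSUD => ?_⟩
  have hP3SD : OMD.IsP3Solution H₁₁ H₂₁ S₂ P₁ 1 SSD := hSD.isP3Solution_one hP₁ H₂₁ S₂
  have hP3SUD : OMD.IsP3Solution H₁₁ H₂₁ S₂ P₁ 0 SSUD := hSUD.isP3Solution_zero hS₂ hP₁
  have hRab := OMD.Ra_le_Rb H₁₁ H₂₁ hS₂ hP3SUD.1.1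
  exact ⟨OMD.Ra_le_Ra_of_isP3Solution hS₂ hP3SD hP3SUD, hRab,
    hSD.isOMDSolution_SD hS₂ hP₁ hH₁₁,
    fun hr => ⟨OMD.exists_isDualOptimal hS₂ hH₁₁ hP₁ (hr.trans hRab), fun μ₁ _ hμ =>
      ⟨OMD.exists_isP3Solution H₁₁ H₂₁ hS₂ hP₁.le μ₁,
        fun _ => hμ.isOMDSolution hS₂ hH₁₁ hP₁ hP3SUD hr⟩⟩,
    hSUD.isOMDSolution_JD hS₂ hP₁ hH₁₁, hSUD.isOMDSolution_SUD hS₂ hP₁ hH₁₁⟩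

theorem theorem3p1 {m n₁ n₂ : ℕ}
    (H₁₁ : Matrix (Fin m) (Fin n₁) ℂ) (H₂₁ : Matrix (Fin m) (Fin n₂) ℂ)
    (S₂ : Matrix (Fin n₂) (Fin n₂) ℂ) (hS₂ : S₂.PosSemidef)
    (P₁ r₂ : ℝ) (hP₁ : 0 < P₁) (hH₁₁ : H₁₁ ≠ 0) :
    -- the two water-filling solutions exist
    (∃ S r, OMD.IsWaterFilling H₁₁ P₁ S r) ∧
    (∃ S r, OMD.IsWaterFilling (OMD.whitened H₁₁ H₂₁ S₂) P₁ S r) ∧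
    ∀ (SSD SSUD : Matrix (Fin n₁) (Fin n₁) ℂ) (rSD rSUD : ℝ),
      OMD.IsWaterFilling H₁₁ P₁ SSD rSD →
      OMD.IsWaterFilling (OMD.whitened H₁₁ H₂₁ S₂) P₁ SSUD rSUD →
      -- the order of the thresholds
      OMD.Ra H₁₁ H₂₁ S₂ SSD ≤ OMD.Ra H₁₁ H₂₁ S₂ SSUD ∧
      OMD.Ra H₁₁ H₂₁ S₂ SSUD ≤ OMD.Rb H₂₁ S₂ ∧
      -- first regime
      (0 < r₂ → r₂ < OMD.Ra H₁₁ H₂₁ S₂ SSD →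
        OMD.IsOMDSolution H₁₁ H₂₁ S₂ P₁ r₂ SSD rSD .SD) ∧
      -- second regime
      (OMD.Ra H₁₁ H₂₁ S₂ SSD ≤ r₂ → r₂ ≤ OMD.Ra H₁₁ H₂₁ S₂ SSUD →
        (∃ μ₁ μ₂, OMD.IsDualOptimal H₁₁ H₂₁ S₂ P₁ r₂ μ₁ μ₂) ∧
        ∀ μ₁ μ₂, OMD.IsDualOptimal H₁₁ H₂₁ S₂ P₁ r₂ μ₁ μ₂ →
          (∃ S, OMD.IsP3Solution H₁₁ H₂₁ S₂ P₁ μ₁ S) ∧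
          ∀ S, OMD.IsP3Solution H₁₁ H₂₁ S₂ P₁ μ₁ S →
            OMD.IsOMDSolution H₁₁ H₂₁ S₂ P₁ r₂ S (OMD.ownRate H₁₁ S) .SD) ∧
      -- third regime
      (OMD.Ra H₁₁ H₂₁ S₂ SSUD < r₂ → r₂ ≤ OMD.Rb H₂₁ S₂ →
        OMD.IsOMDSolution H₁₁ H₂₁ S₂ P₁ r₂ SSUD (rSUD + OMD.Rb H₂₁ S₂ - r₂) .JD) ∧
      -- fourth regime
      (OMD.Rb H₂₁ S₂ < r₂ →
        OMD.IsOMDSolution H₁₁ H₂₁ S₂ P₁ r₂ SSUD rSUD .SUD) := by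
  obtain ⟨hexSD, hexSUD, h⟩ := theorem3p1_general H₁₁ H₂₁ S₂ hS₂ P₁ r₂ hP₁ hH₁₁
  refine ⟨hexSD, hexSUD, fun SSD SSUD rSD rSUD hSD hSUD => ?_⟩
  obtain ⟨hRa, hRb, hSDcase, hdual, hJD, hSUDcase⟩ := h SSD SSUD rSD rSUD hSD hSUD
  exact ⟨hRa, hRb, fun _ hr => hSDcase hr.le, fun _ => hdual, hJD, hSUDcase⟩
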